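/- Let $N\ge 1$ and $j\ge 0$ be integers. Consider chains $(\mathbb A,B_1,\dots,B_j)$ of $N\times N$ complex matrices and the field of rational functions in their $N^2(j+1)$ independent entries. Let $E_{ab}$ denote the matrix units, put $\theta(x)=1,\tfrac12,0$ for $x>0$, $x=0$, $x<0$, let $r_{12}=2\sum_{a,b}\theta(a-b)\,E_{ab}\otimes E_{ba}$, let $t_i$ be transposition in the $i$-th tensor factor, and write $\overset{1}{X}=X\otimes 1$, $\overset{2}{X}=1\otimes X$. For matrices $X,Y$ of functions, $\{\overset{1}{X}\overset{\otimes}{,}\overset{2}{Y}\}$ is the tensor whose component with row index $(a,c)$ and column index $(b,d)$ is $\{X_{ab},Y_{cd}\}$. The type-(ii) Poisson bracket is the skew-symmetric bi-derivation with $$\{\overset{1}{\mathbb A}\overset{\otimes}{,}\overset{2}{\mathbb A}\}=r_{12}\overset{1}{\mathbb A}\overset{2}{\mathbb A}-\overset{1}{\mathbb A}\overset{2}{\mathbb A}r_{12}+\overset{1}{\mathbb A}r_{12}^{t_1}\overset{2}{\mathbb A}-\overset{2}{\mathbb A}r_{12}^{t_1}\overset{1}{\mathbb A},$$ $$\{\overset{1}{B_k}\overset{\otimes}{,}\overset{2}{B_k}\}=r_{12}\overset{1}{B_k}\overset{2}{B_k}-\overset{1}{B_k}\overset{2}{B_k}r_{12},$$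 $$\{\overset{1}{B_1}\overset{\otimes}{,}\overset{2}{\mathbb A}\}=\overset{1}{B_1}Q_{12}\overset{2}{\mathbb A}+\overset{1}{B_1}\overset{2}{\mathbb A}Q_{12}^{t_2},\qquad \{\overset{1}{B_{k+1}}\overset{\otimes}{,}\overset{2}{B_k}\}=\overset{1}{B_{k+1}}Q_{12}\overset{2}{B_k},\qquad Q_{12}=-r_{12}^{t_2},$$ where $\{B_k,\mathbb A\}=0$ for $k\ge2$ and $\{B_k,B_l\}=0$ for $|k-l|>1$. A Casimir function is a function whose bracket with every function vanishes. For a matrix $B$ let $M_B^q$ be its upper-right $q\times q$ minor ($M_B^0=1$). Let $$S=\mathbb A^{T}B_1^{-1}B_2^{T}B_3^{-1}\cdots,$$ the last factor being $B_j^{-1}$ for odd $j$ and $B_j^{T}$ for even $j$. Let $M_S^q$ be the upper-right $q\times q$ minor of $S$ if $j$ is even, and the principal upper-left $q\times q$ minor of $S$ if $j$ is odd. Then the following are Casimir functions of this bracket. 1. For all $j$: the $[N/2]$ functions $Y_p$, $1\le p\le [N/2]$, defined by $$\frac{\det(\lambda\mathbb A+\lambda^{-1}\mathbb A^{T})}{\det\mathbb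 A}=(\lambda^N+\lambda^{-N})+\sum_{p=1}^{[N/2]}(\lambda^{N-2p}+\lambda^{2p-N})\,Y_p .$$ 2. For even $j$: the $[(N+1)/2]$ functions $$X_p=\frac{M_S^p\prod_{k=1}^jM_{B_k}^p}{M_S^{N-p}\prod_{k=1}^jM_{B_k}^{N-p}},\qquad 0\le p\le \Big[\frac{N+1}2\Big]-1 .$$ 3. For odd $j=2r+1$: the $[N/2]$ functions $$X_p=\frac{M_S^pM_S^{N-p}\prod_{k=1}^r M_{B_{2k}}^pM_{B_{2k}}^{N-p}}{\prod_{k=1}^{r+1}M_{B_{2k-1}}^pM_{B_{2k-1}}^{N-p}}\cdot\frac{\prod_{k=1}^{r+1}(\det B_{2k-1})^2}{\det\mathbb A\,\prod_{k=1}^r(\det B_{2k})^2},\qquad 1\le p\le [N/2].$$ For even $j$ the functions in 1 and 2 together are algebraically independent over $\mathbb C$, which gives $[N/2]+[(N+1)/2]=N$ Casimir functions; for odd $j$ the functions in 1 and 3 together are algebraically independent over $\mathbb C$, which gives $2[N/2]$ Casimir functions. -/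

import Mathlib

open scoped Kronecker KaehlerDifferential

noncomputable section

namespace BChain

/-! The phase space consists of chains `(A, B_1, …, B_j)` of `N × N` complex matrices. -/

/-- Index of a coordinate: `(k, a, b)` is the entry `(a, b)` of `A` if `k = 0`, of `B_k` if
`k ≥ 1`. -/
abbrev Idx (N j : ℕ) : Type := Fin (j + 1) × Fin N × Fin N

/-- The field of rational functions on the phase space. -/
abbrev RatFun (N j : ℕ) : Type := FractionRing (MvPolynomial (Idx N j) ℂ)

/-- A coordinate function. -/
def coord (N j : ℕ) (u : Idx N j) : RatFun N j :=
  algebraMap (MvPolynomial (Idx N j) ℂ) (RatFun N j) (MvPolynomial.X u)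

/-- The matrix of coordinate functions: `A` for `k = 0` and `B_k` for `k ≥ 1`. -/
def mat (N j : ℕ) (k : Fin (j + 1)) : Matrix (Fin N) (Fin N) (RatFun N j) :=
  Matrix.of fun a b => coord N j (k, a, b)

theorem isUnit_scalar (N j : ℕ) (s : nonZeroDivisors (MvPolynomial (Idx N j) ℂ)) :
    IsUnit (algebraMap _ (Module.End (MvPolynomial (Idx N j) ℂ) (RatFun N j)) s.val) :=
  IsLocalizedModule.map_units (S := nonZeroDivisors (MvPolynomial (Idx N j) ℂ))
    (Algebra.linearMap (MvPolynomial (Idx N j) ℂ) (RatFun N j)) s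

/-- The linear form on Kähler differentials extending `d p ↦ ∂p/∂u` for polynomials `p`. -/
def kaehlerForm (N j : ℕ) (u : Idx N j) :
    Ω[RatFun N j⁄ℂ] →ₗ[MvPolynomial (Idx N j) ℂ] RatFun N j :=
  IsLocalizedModule.lift (nonZeroDivisors (MvPolynomial (Idx N j) ℂ))
    (KaehlerDifferential.map ℂ ℂ (MvPolynomial (Idx N j) ℂ) (RatFun N j))
    (Algebra.linearMap (MvPolynomial (Idx N j) ℂ) (RatFun N j) ∘ₗ
      (MvPolynomial.pderiv (R := ℂ) u).liftKaehlerDifferential)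
    (isUnit_scalar N j)

/-- The partial derivative with respect to one coordinate, as the derivation of the field of
rational functions extending the partial derivative of polynomials. -/
def partialDeriv (N j : ℕ) (u : Idx N j) : Derivation ℂ (RatFun N j) (RatFun N j) :=
  ((kaehlerForm N j u).extendScalarsOfIsLocalization
    (nonZeroDivisors (MvPolynomial (Idx N j) ℂ)) (RatFun N j)).compDer
    (KaehlerDifferential.D ℂ (RatFun N j))

theorem partialDeriv_algebraMap (N j : ℕ) (u : Idx N j) (p : MvPolynomial (Idx N j) ℂ) :
    partialDeriv N j u (algebraMap _ (RatFun N j) p) =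
      algebraMap _ (RatFun N j) (MvPolynomial.pderiv u p) := by
  have h : KaehlerDifferential.D ℂ (RatFun N j) (algebraMap _ (RatFun N j) p) =
      KaehlerDifferential.map ℂ ℂ (MvPolynomial (Idx N j) ℂ) (RatFun N j)
        (KaehlerDifferential.D ℂ _ p) := by
    simp
  change kaehlerForm N j u
    (KaehlerDifferential.D ℂ (RatFun N j) (algebraMap _ (RatFun N j) p)) = _
  rw [h, kaehlerForm, IsLocalizedModule.lift_apply]
  simp

section RMatrix

variable (N : ℕ) (K : Type*) [Field K]

/-- `θ(a - b)`, with `θ(x) = 1, 1/2, 0` for `x > 0`, `x = 0`, `x < 0`. -/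
def theta (a b : Fin N) : K := if b < a then 1 else if a = b then 1 / 2 else 0

/-- The trigonometric `r`-matrix `r₁₂ = 2 ∑ θ(a - b) E_{ab} ⊗ E_{ba}`. -/
def rMat : Matrix (Fin N × Fin N) (Fin N × Fin N) K :=
  ∑ a, ∑ b, (2 * theta N K a b) •
    (Matrix.single a b (1 : K) ⊗ₖ Matrix.single b a (1 : K))

variable {N K}

/-- Transposition in the first tensor factor. -/
def transpose₁ (M : Matrix (Fin N × Fin N) (Fin N × Fin N) K) :
    Matrix (Fin N × Fin N) (Fin N × Fin N) K :=
  Matrix.of fun x y => M (y.1, x.2) (x.1, y.2)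

/-- Transposition in the second tensor factor. -/
def transpose₂ (M : Matrix (Fin N × Fin N) (Fin N × Fin N) K) :
    Matrix (Fin N × Fin N) (Fin N × Fin N) K :=
  Matrix.of fun x y => M (x.1, y.2) (y.1, x.2)

/-- `X ⊗ 1`. -/
def inFirst (X : Matrix (Fin N) (Fin N) K) : Matrix (Fin N × Fin N) (Fin N × Fin N) K :=
  X ⊗ₖ (1 : Matrix (Fin N) (Fin N) K)

/-- `1 ⊗ X`. -/
def inSecond (X : Matrix (Fin N) (Fin N) K) : Matrix (Fin N × Fin N) (Fin N × Fin N) K :=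
  (1 : Matrix (Fin N) (Fin N) K) ⊗ₖ X

variable (N K) in
/-- The coupling matrix of type (ii): `Q₁₂ = -r₁₂^{t₂}`. -/
def QMat : Matrix (Fin N × Fin N) (Fin N × Fin N) K := -transpose₂ (rMat N K)

/-- `{A ⊗ A} = r (A ⊗ A) - (A ⊗ A) r + A₁ r^{t₁} A₂ - A₂ r^{t₁} A₁`. -/
def bracketAA (A : Matrix (Fin N) (Fin N) K) : Matrix (Fin N × Fin N) (Fin N × Fin N) K :=
  rMat N K * (A ⊗ₖ A) - (A ⊗ₖ A) * rMat N K
    + inFirst A * transpose₁ (rMat N K) * inSecond A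
    - inSecond A * transpose₁ (rMat N K) * inFirst A

/-- `{B ⊗ B} = r (B ⊗ B) - (B ⊗ B) r`. -/
def bracketBB (B : Matrix (Fin N) (Fin N) K) : Matrix (Fin N × Fin N) (Fin N × Fin N) K :=
  rMat N K * (B ⊗ₖ B) - (B ⊗ₖ B) * rMat N K

/-- `{B ⊗ A} = B₁ Q A₂ + B₁ A₂ Q^{t₂}`. -/
def bracketBA (B A : Matrix (Fin N) (Fin N) K) : Matrix (Fin N × Fin N) (Fin N × Fin N) K :=
  inFirst B * QMat N K * inSecond A + inFirst B * inSecond A * transpose₂ (QMat N K)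

/-- `{B' ⊗ B} = B'₁ Q B₂`, for consecutive members `B = B_k`, `B' = B_{k+1}` of the chain. -/
def bracketNext (B' B : Matrix (Fin N) (Fin N) K) :
    Matrix (Fin N × Fin N) (Fin N × Fin N) K :=
  inFirst B' * QMat N K * inSecond B

end RMatrix

/-- The tensor `{M_k ⊗ M_l}` of brackets of the entries of consecutive matrices, `k = l + 1`,
where `M_0 = A` and `M_k = B_k` for `k ≥ 1`. -/
def bracketStep (N j : ℕ) (k l : Fin (j + 1)) :
    Matrix (Fin N × Fin N) (Fin N × Fin N) (RatFun N j) :=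
  if l = 0 then bracketBA (mat N j k) (mat N j l) else bracketNext (mat N j k) (mat N j l)

/-- The bracket of two coordinate functions. The bracket `{M_{a,b}, M'_{c,d}}` is the component
with row index `(a, c)` and column index `(b, d)` of the tensor `{M ⊗ M'}`; matrices of the chain
that are neither equal nor consecutive commute. -/
def structureFun (N j : ℕ) : Idx N j → Idx N j → RatFun N j :=
  fun ⟨k, a, b⟩ ⟨l, c, d⟩ =>
    if k = l then
      (if k = 0 then bracketAA (mat N j k) else bracketBB (mat N j k)) (a, c) (b, d)
    else if k.val = l.val + 1 then bracketStep N j k l (a, c) (b, d)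
    else if l.val = k.val + 1 then -bracketStep N j l k (c, a) (d, b)
    else 0

/-- The type (ii) bracket of rational functions on the space of chains. -/
def bracket (N j : ℕ) (f g : RatFun N j) : RatFun N j :=
  ∑ u, ∑ v, structureFun N j u v * partialDeriv N j u f * partialDeriv N j v g

theorem bracket_coord (N j : ℕ) (u v : Idx N j) :
    bracket N j (coord N j u) (coord N j v) = structureFun N j u v := by
  classical
  simp only [bracket, coord, partialDeriv_algebraMap, MvPolynomial.pderiv_X]
  rw [Finset.sum_eq_single u, Finset.sum_eq_single v]
  · simp
  · intro w _ hw
    simp [Pi.single_eq_of_ne (Ne.symm hw)]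
  · simp
  · intro w _ hw
    simp [Pi.single_eq_of_ne (Ne.symm hw)]
  · simp

/-- Casimir functions: those commuting with all functions. -/
def IsCasimir (N j : ℕ) (f : RatFun N j) : Prop := ∀ g, bracket N j f g = 0

section Minors

variable {N : ℕ} {K : Type*} [Field K]

/-- The `p × p` minor in the upper-right corner. -/
def urMinor (M : Matrix (Fin N) (Fin N) K) (p : ℕ) (hp : p ≤ N) : K :=
  (M.submatrix (Fin.castLE hp) (fun b : Fin p => (⟨N - p + b.val, by omega⟩ : Fin N))).det

/-- The `p × p` principal minor in the upper-left corner. -/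
def ulMinor (M : Matrix (Fin N) (Fin N) K) (p : ℕ) (hp : p ≤ N) : K :=
  (M.submatrix (Fin.castLE hp) (Fin.castLE hp)).det

end Minors

/-- `S = Aᵀ B₁⁻¹ B₂ᵀ B₃⁻¹ ⋯`, ending in `B_j⁻¹` for odd `j` and in `B_jᵀ` for even `j`. (Here
`k.succ` runs through `1, …, j`, so that `k` is even exactly for the matrices of odd index.) -/
def matS (N j : ℕ) : Matrix (Fin N) (Fin N) (RatFun N j) :=
  (mat N j 0).transpose * (List.ofFn fun k : Fin j =>
    if Even k.val then (mat N j k.succ)⁻¹ else (mat N j k.succ).transpose).prod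

/-- `det (λ A + λ⁻¹ Aᵀ) / det A` as a Laurent polynomial in `λ`. -/
def pencil (N j : ℕ) : LaurentPolynomial (RatFun N j) :=
  LaurentPolynomial.C (mat N j 0).det⁻¹ *
    (Matrix.of fun a b => LaurentPolynomial.T 1 * LaurentPolynomial.C (mat N j 0 a b) +
      LaurentPolynomial.T (-1) * LaurentPolynomial.C (mat N j 0 b a)).det

/-- The function `Y_{p+1}`, `p = 0, …, [N/2] - 1`: the coefficient of
`λ^(N-2(p+1)) + λ^(2(p+1)-N)` in `pencil`, the two powers coinciding when `2(p+1) = N`. -/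
def casimirY (N j : ℕ) (p : Fin (N / 2)) : RatFun N j :=
  if 2 * (p.val + 1) = N then (pencil N j).coeff 0 / 2
  else (pencil N j).coeff ((N : ℤ) - 2 * (p.val + 1))

/-- For even `j` the function `X_p`, `p = 0, …, [(N+1)/2] - 1`. -/
def casimirXEven (N j : ℕ) (p : Fin ((N + 1) / 2)) : RatFun N j :=
  (urMinor (matS N j) p.val (by omega) *
      ∏ k : Fin j, urMinor (mat N j k.succ) p.val (by omega)) /
    (urMinor (matS N j) (N - p.val) (Nat.sub_le _ _) *
      ∏ k : Fin j, urMinor (mat N j k.succ) (N - p.val) (Nat.sub_le _ _))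

/-- For `j = 2 r + 1` the function `X_{p+1}`, `p = 0, …, [N/2] - 1`. -/
def casimirXOdd (N r : ℕ) (p : Fin (N / 2)) : RatFun N (2 * r + 1) :=
  let S := matS N (2 * r + 1)
  let A := mat N (2 * r + 1) 0
  -- the matrices `B_2, B_4, …, B_{2r}`
  let Bev : Fin r → Matrix (Fin N) (Fin N) (RatFun N (2 * r + 1)) :=
    fun k => mat N (2 * r + 1) ⟨2 * (k.val + 1), by omega⟩
  -- the matrices `B_1, B_3, …, B_{2r+1}`
  let Bodd : Fin (r + 1) → Matrix (Fin N) (Fin N) (RatFun N (2 * r + 1)) :=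
    fun k => mat N (2 * r + 1) ⟨2 * k.val + 1, by omega⟩
  have hp : p.val + 1 ≤ N := by omega
  have hq : N - (p.val + 1) ≤ N := Nat.sub_le _ _
  (ulMinor S (p.val + 1) hp * ulMinor S (N - (p.val + 1)) hq *
      ∏ k, (urMinor (Bev k) (p.val + 1) hp * urMinor (Bev k) (N - (p.val + 1)) hq)) /
    (∏ k, (urMinor (Bodd k) (p.val + 1) hp * urMinor (Bodd k) (N - (p.val + 1)) hq)) *
    ((∏ k, (Bodd k).det ^ 2) / (A.det * ∏ k, (Bev k).det ^ 2))

end BChain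

end

/-! For each coordinate function `u`, the derivation `{·, u}` moves the chain by infinitesimal
multiplications: `A ↦ G₀ A + A G₀ᵀ` and `B_k ↦ G_k B_k + B_k H_k`, with `G_k`, `H_k` lower
triangular for `k ≥ 1` (`chainFlow_zero`, `chainFlow_succ`). `G₀` need not be triangular, but along
`S` the multipliers telescope to `L S + S Q_j` for even `j` and `L S - S Q_jᵀ` for odd `j`, with
`L`, `Q_j` lower triangular (`ChainFlow.map_matS`). The cancellation rests on `θ(x) + θ(-x) = 1`.

Triangular multipliers make the corner minors eigenvectors, with partial diagonal sums as
eigenvalues (`isEigen_urMinor`, `isEigen_ulMinor`). For even `j` the eigenvalue of `M_S^p ∏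
M_{B_k}^p` is symmetric under `p ↔ N - p`, so it cancels in `X_p` (`evenWeight_succ`,
`evenWeight_zero`). For odd `j` the determinants in `X_p` absorb what the minors leave over
(`oddWeight_succ`, `oddWeight_zero`). The `Y_p` are, up to a factor `1/2` in the middle, ratios of
coefficients of `det (X A + Aᵀ)` to `det A`, and all of these scale by `2 tr G₀`
(`derivation_coeff_pencilPoly`).

For independence, the `Y_p` are specialized to an antidiagonal `A`, where the roots of the pencil
are visible (`congruenceInvariant_algebraicIndependent`). The torus `A ↦ T A T`, `B₁ ↦ B₁ T` fixes
the `Y_p` and scales the nonzero `X_p` by characters with a triangular, invertible exponent matrix.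
Distinct monomials in the `X_p` then have distinct weights, so no relation over `ℂ[Y]` exists
(`algebraicIndependent_sumElim_of_eigen`). -/

noncomputable section

namespace BChain

/-! ### Derivations applied to products, inverses and determinants. -/

section MatrixDerivation

variable {F K : Type*} [CommRing F] [CommRing K] [Algebra F K] (δ : Derivation F K K)

theorem map_mul_derivation {l m n : Type*} [Fintype m] (X : Matrix l m K) (Y : Matrix m n K) :
    (X * Y).map δ = X.map δ * Y + X * Y.map δ := by
  ext a b
  simp only [Matrix.map_apply, Matrix.mul_apply, Matrix.add_apply, map_sum, Derivation.leibniz,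
    smul_eq_mul, ← Finset.sum_add_distrib]
  exact Finset.sum_congr rfl fun c _ => by ring

theorem map_one_derivation {n : Type*} [DecidableEq n] :
    (1 : Matrix n n K).map δ = 0 := by
  ext a b
  by_cases h : a = b <;> simp [h]

theorem map_inv_derivation {n : Type*} [Fintype n] [DecidableEq n] (X : Matrix n n K)
    (hX : IsUnit X.det) : (X⁻¹).map δ = -(X⁻¹ * X.map δ * X⁻¹) := by
  have h := map_mul_derivation δ X⁻¹ X
  rw [Matrix.nonsing_inv_mul X hX, map_one_derivation] at h
  have h2 : (X⁻¹).map δ * X = -(X⁻¹ * X.map δ) := eq_neg_of_add_eq_zero_left h.symm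
  calc (X⁻¹).map δ = (X⁻¹).map δ * X * X⁻¹ := (Matrix.mul_nonsing_inv_cancel_right _ _ hX).symm
    _ = _ := by rw [h2, neg_mul]

theorem derivation_prod {ι : Type*} [DecidableEq ι] (s : Finset ι) (f : ι → K) :
    δ (∏ i ∈ s, f i) = ∑ i ∈ s, (∏ k ∈ s.erase i, f k) * δ (f i) := by
  induction s using Finset.induction_on with
  | empty => simp
  | insert a s ha ih =>
    rw [Finset.prod_insert ha, Derivation.leibniz, ih, Finset.sum_insert ha,
      Finset.erase_insert ha, smul_eq_mul, smul_eq_mul, Finset.mul_sum, add_comm]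
    congr 1
    refine Finset.sum_congr rfl fun i hi => ?_
    have hai : a ≠ i := fun h => ha (h ▸ hi)
    rw [Finset.erase_insert_of_ne hai,
      Finset.prod_insert fun h => ha (Finset.mem_of_mem_erase h), mul_assoc]

/-- Jacobi's formula: differentiate one row at a time, then expand each determinant along the
differentiated row. -/
theorem derivation_det {n : Type*} [Fintype n] [DecidableEq n] (X : Matrix n n K) :
    δ X.det = (X.adjugate * X.map δ).trace := by
  have h1 : δ X.det = ∑ i, (X.updateRow i fun b => δ (X i b)).det := by
    simp only [Matrix.det_apply', map_sum]
    rw [Finset.sum_comm]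
    refine Finset.sum_congr rfl fun σ _ => ?_
    have hc : δ ((Equiv.Perm.sign σ : ℤ) : K) = 0 := by simp
    rw [Derivation.leibniz, hc, smul_zero, add_zero, smul_eq_mul, derivation_prod,
      Finset.mul_sum]
    -- In the Leibniz expansion the factor of column `i` lies in row `σ i`; reindexing by `σ` turns
    -- the sum over columns into one over rows.
    refine Finset.sum_equiv σ (by simp) fun i _ => ?_
    congr 1
    rw [← Finset.mul_prod_erase _ _ (Finset.mem_univ i), mul_comm]
    congr 1
    · simp
    · refine Finset.prod_congr rfl fun k hk => ?_
      rw [Matrix.updateRow_ne]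
      exact fun h => (Finset.ne_of_mem_erase hk) (σ.injective h)
  rw [h1, Matrix.trace_mul_comm, Matrix.trace]
  refine Finset.sum_congr rfl fun i _ => ?_
  rw [Matrix.diag_apply, Matrix.mul_apply, ← Matrix.cramer_transpose_apply,
    Matrix.cramer_eq_adjugate_mulVec, Matrix.mulVec, dotProduct]
  refine Finset.sum_congr rfl fun b _ => ?_
  rw [← Matrix.adjugate_transpose, Matrix.transpose_apply, Matrix.map_apply, mul_comm]

theorem derivation_det_of_map_eq {n : Type*} [Fintype n] [DecidableEq n] {X G H : Matrix n n K}
    (h : X.map δ = G * X + X * H) : δ X.det = (G.trace + H.trace) * X.det := by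
  rw [derivation_det, h, Matrix.mul_add, Matrix.trace_add, ← Matrix.mul_assoc, ← Matrix.mul_assoc,
    Matrix.adjugate_mul, Matrix.mul_assoc, Matrix.trace_mul_comm, Matrix.mul_assoc,
    Matrix.mul_adjugate]
  simp
  ring

end MatrixDerivation

/-! ### Eigenvectors of a derivation, with eigenvalues adding under multiplication. -/

section Eigen

variable {F K : Type*} [Field F] [Field K] [Algebra F K] (δ : Derivation F K K)

/-- `f` is an eigenvector of `δ`, with eigenvalue `w` in the field itself. -/
def IsEigen (f w : K) : Prop := δ f = w * f

variable {δ}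

namespace IsEigen

theorem one : IsEigen δ (1 : K) 0 := by simp [IsEigen]

theorem mul {f g v w : K} (hf : IsEigen δ f v) (hg : IsEigen δ g w) :
    IsEigen δ (f * g) (v + w) := by
  rw [IsEigen, Derivation.leibniz, hf, hg]
  simp only [smul_eq_mul]
  ring

theorem inv {f w : K} (hf : IsEigen δ f w) : IsEigen δ f⁻¹ (-w) := by
  rcases eq_or_ne f 0 with rfl | h
  · simp [IsEigen]
  · rw [IsEigen, Derivation.leibniz_inv, hf]
    simp only [smul_eq_mul]
    field_simp

theorem div {f g v w : K} (hf : IsEigen δ f v) (hg : IsEigen δ g w) :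
    IsEigen δ (f / g) (v - w) := by
  rw [div_eq_mul_inv, sub_eq_add_neg]
  exact hf.mul hg.inv

theorem sq {f v : K} (hf : IsEigen δ f v) : IsEigen δ (f ^ 2) (2 * v) := by
  rw [pow_two, two_mul]
  exact hf.mul hf

theorem prod {ι : Type*} {s : Finset ι} {f w : ι → K} (h : ∀ i ∈ s, IsEigen δ (f i) (w i)) :
    IsEigen δ (∏ i ∈ s, f i) (∑ i ∈ s, w i) := by
  classical
  induction s using Finset.induction_on with
  | empty => simpa using one
  | insert a s ha ih =>
    rw [Finset.prod_insert ha, Finset.sum_insert ha]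
    exact (h a (Finset.mem_insert_self a s)).mul
      (ih fun i hi => h i (Finset.mem_insert_of_mem hi))

theorem pow {f v : K} (hf : IsEigen δ f v) (n : ℕ) : IsEigen δ (f ^ n) (n * v) := by
  induction n with
  | zero => simpa using one
  | succ n ih =>
    rw [pow_succ, Nat.cast_succ, add_mul, one_mul]
    exact ih.mul hf

end IsEigen

end Eigen

/-! ### Corner minors under triangular multiplications. -/

section Triangular

variable {F K : Type*} [Field F] [Field K] [Algebra F K] {δ : Derivation F K K} {N : ℕ}

/-- Lower triangular matrices. -/
def IsLower (G : Matrix (Fin N) (Fin N) K) : Prop := ∀ a b, a < b → G a b = 0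

namespace IsLower

theorem zero : IsLower (0 : Matrix (Fin N) (Fin N) K) := fun _ _ _ => rfl

theorem neg {G : Matrix (Fin N) (Fin N) K} (hG : IsLower G) : IsLower (-G) := fun a b h => by
  simp [hG a b h]

theorem add {G H : Matrix (Fin N) (Fin N) K} (hG : IsLower G) (hH : IsLower H) :
    IsLower (G + H) := fun a b h => by
  simp [hG a b h, hH a b h]

end IsLower

/-- The sum of the first `p` diagonal entries. -/
def headTrace (G : Matrix (Fin N) (Fin N) K) (p : ℕ) (hp : p ≤ N) : K :=
  ∑ a : Fin p, G (Fin.castLE hp a) (Fin.castLE hp a)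

/-- The sum of the last `p` diagonal entries. -/
def tailTrace (G : Matrix (Fin N) (Fin N) K) (p : ℕ) (_ : p ≤ N) : K :=
  ∑ a : Fin p, G ⟨N - p + a.val, by omega⟩ ⟨N - p + a.val, by omega⟩

theorem submatrix_mul_of_eq_zero {m n p q : Type*} [Fintype m] [Fintype p]
    (X : Matrix n m K) (Y : Matrix m q K) {r s : Type*} (f : r → n) (g : p → m) (h : s → q)
    (hg : Function.Injective g) (hz : ∀ i k j, k ∉ Set.range g → X (f i) k * Y k (h j) = 0) :
    (X * Y).submatrix f h = X.submatrix f g * Y.submatrix g h := by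
  classical
  ext i j
  simp only [Matrix.submatrix_apply, Matrix.mul_apply]
  rw [← Finset.sum_image (s := Finset.univ) (g := g) (f := fun k => X (f i) k * Y k (h j))
    (fun a _ b _ hab => hg hab)]
  refine (Finset.sum_subset (Finset.subset_univ _) fun k _ hk => hz i k j ?_).symm
  simpa using hk

/-- With `G` lower triangular, the first `p` rows of `G X` involve only the first `p` rows of `X`;
with `H` lower triangular, the last `p` columns of `X H` involve only the last `p` columns. So the
corner block itself evolves by two-sided multiplication. -/
theorem isEigen_urMinor {X G H : Matrix (Fin N) (Fin N) K} (h : X.map δ = G * X + X * H)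
    (hG : IsLower G) (hH : IsLower H) (p : ℕ) (hp : p ≤ N) :
    IsEigen δ (urMinor X p hp) (headTrace G p hp + tailTrace H p hp) := by
  refine derivation_det_of_map_eq δ (G := G.submatrix (Fin.castLE hp) (Fin.castLE hp))
    (H := H.submatrix (fun b : Fin p => (⟨N - p + b.val, by omega⟩ : Fin N))
      (fun b : Fin p => (⟨N - p + b.val, by omega⟩ : Fin N))) ?_
  rw [← submatrix_mul_of_eq_zero, ← submatrix_mul_of_eq_zero, ← Matrix.submatrix_map, h]
  · rfl
  · intro a b hab
    simpa [Fin.ext_iff] using hab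
  · intro i k j hk
    rw [hH, mul_zero]
    by_contra hlt
    rw [Fin.lt_def, not_lt] at hlt
    simp only at hlt
    exact hk ⟨⟨k.val - (N - p), by omega⟩, by ext; simp; omega⟩
  · exact Fin.castLE_injective hp
  · intro i k j hk
    rw [hG, zero_mul]
    by_contra hlt
    rw [Fin.lt_def, not_lt, Fin.val_castLE] at hlt
    exact hk ⟨⟨k.val, by omega⟩, by ext; simp⟩

/-- An upper triangular right factor preserves the span of the first `p` columns, hence the
upper-left block in place of the upper-right one. -/
theorem isEigen_ulMinor {X G H : Matrix (Fin N) (Fin N) K} (h : X.map δ = G * X + X * H)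
    (hG : IsLower G) (hH : IsLower H.transpose) (p : ℕ) (hp : p ≤ N) :
    IsEigen δ (ulMinor X p hp) (headTrace G p hp + headTrace H p hp) := by
  refine derivation_det_of_map_eq δ (G := G.submatrix (Fin.castLE hp) (Fin.castLE hp))
    (H := H.submatrix (Fin.castLE hp) (Fin.castLE hp)) ?_
  rw [← submatrix_mul_of_eq_zero, ← submatrix_mul_of_eq_zero, ← Matrix.submatrix_map, h]
  · rfl
  · exact Fin.castLE_injective hp
  · intro i k j hk
    have := hH (Fin.castLE hp j) k
    rw [Matrix.transpose_apply] at this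
    rw [this, mul_zero]
    by_contra hlt
    rw [Fin.lt_def, not_lt, Fin.val_castLE] at hlt
    exact hk ⟨⟨k.val, by omega⟩, by ext; simp⟩
  · exact Fin.castLE_injective hp
  · intro i k j hk
    rw [hG, zero_mul]
    by_contra hlt
    rw [Fin.lt_def, not_lt, Fin.val_castLE] at hlt
    exact hk ⟨⟨k.val, by omega⟩, by ext; simp⟩

theorem headTrace_of_diag {G : Matrix (Fin N) (Fin N) K} {x : K} {c : Fin N}
    (hG : ∀ a, G a a = if a = c then x else 0) (p : ℕ) (hp : p ≤ N) :
    headTrace G p hp = if c.val < p then x else 0 := by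
  simp only [headTrace, hG]
  split_ifs with h
  · rw [Finset.sum_eq_single ⟨c.val, h⟩]
    · simp
    · intro b _ hb
      rw [if_neg]
      intro hc
      exact hb (by ext; simp [← hc])
    · simp
  · refine Finset.sum_eq_zero fun b _ => if_neg ?_
    intro hc
    have := b.isLt
    exact h (by rw [← hc]; simp)

theorem tailTrace_of_diag {G : Matrix (Fin N) (Fin N) K} {x : K} {c : Fin N}
    (hG : ∀ a, G a a = if a = c then x else 0) (p : ℕ) (hp : p ≤ N) :
    tailTrace G p hp = if N - p ≤ c.val then x else 0 := by
  simp only [tailTrace, hG]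
  split_ifs with h
  · rw [Finset.sum_eq_single ⟨c.val - (N - p), by omega⟩]
    · rw [if_pos]
      ext
      simp
      omega
    · intro b _ hb
      rw [if_neg]
      intro hc
      exact hb (by ext; simp [← hc])
    · simp
  · refine Finset.sum_eq_zero fun b _ => if_neg ?_
    intro hc
    exact h (by rw [← hc]; simp)

end Triangular

/-! ### Telescoping along a product of matrices. -/

section MatrixChain

variable {F K : Type*} [Field F] [Field K] [Algebra F K] {δ : Derivation F K K}

/-- `R k` is the right multiplier of the partial product with `k` factors; `hf` pushes it through
the next factor. -/
theorem map_mul_prod_ofFn {n : Type*} [Fintype n] [DecidableEq n] (L : Matrix n n K) (j : ℕ)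
    (f : Fin j → Matrix n n K) (R : ℕ → Matrix n n K) (X : Matrix n n K)
    (hX : X.map δ = L * X + X * R 0)
    (hf : ∀ k : Fin j, R k * f k + (f k).map δ = f k * R (k + 1)) :
    (X * (List.ofFn f).prod).map δ =
      L * (X * (List.ofFn f).prod) + X * (List.ofFn f).prod * R j := by
  induction j generalizing X R with
  | zero => simpa using hX
  | succ j ih =>
    rw [List.ofFn_succ, List.prod_cons, ← Matrix.mul_assoc]
    refine ih (fun k => f k.succ) (fun k => R (k + 1)) (X * f 0) ?_ fun k => by
      simpa using hf k.succ
    have h0 := hf 0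
    simp only [Fin.val_zero, zero_add] at h0
    rw [map_mul_derivation, hX, zero_add, Matrix.mul_assoc X, ← h0]
    simp only [Matrix.add_mul, Matrix.mul_add, Matrix.mul_assoc, add_assoc]

end MatrixChain

/-! ### Flows on the chain and their effect on `S` and its minors. -/

/-- The matrix of coordinate functions as a matrix of polynomials. -/
def polyMat (N j : ℕ) (k : Fin (j + 1)) : Matrix (Fin N) (Fin N) (MvPolynomial (Idx N j) ℂ) :=
  Matrix.of fun a b => MvPolynomial.X (k, a, b)

theorem map_polyMat (N j : ℕ) (k : Fin (j + 1)) :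
    (polyMat N j k).map (algebraMap _ (RatFun N j)) = mat N j k := rfl

theorem algebraMap_ratFun_injective (N j : ℕ) :
    Function.Injective (algebraMap (MvPolynomial (Idx N j) ℂ) (RatFun N j)) :=
  IsFractionRing.injective _ _

theorem mat_det_eq (N j : ℕ) (k : Fin (j + 1)) :
    (mat N j k).det = algebraMap _ (RatFun N j) (polyMat N j k).det := by
  rw [← map_polyMat, RingHom.map_det]
  rfl

theorem mat_det_ne_zero (N j : ℕ) (k : Fin (j + 1)) : (mat N j k).det ≠ 0 := by
  rw [mat_det_eq, Ne, map_eq_zero_iff _ (algebraMap_ratFun_injective N j)]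
  intro h
  have h1 := congrArg (MvPolynomial.eval
    (fun u : Idx N j => (1 : Matrix (Fin N) (Fin N) ℂ) u.2.1 u.2.2)) h
  rw [RingHom.map_det] at h1
  have h2 : (MvPolynomial.eval fun u : Idx N j =>
      (1 : Matrix (Fin N) (Fin N) ℂ) u.2.1 u.2.2).mapMatrix (polyMat N j k) = 1 := by
    ext a b
    simp [polyMat]
  rw [h2] at h1
  simp at h1

theorem isUnit_mat_det (N j : ℕ) (k : Fin (j + 1)) : IsUnit (mat N j k).det :=
  (mat_det_ne_zero N j k).isUnit

/-- A derivation acting on the chain by infinitesimal two-sided multiplications which are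
compatible with the product `S`. -/
structure ChainFlow (N j : ℕ) (δ : Derivation ℂ (RatFun N j) (RatFun N j))
    (L : Matrix (Fin N) (Fin N) (RatFun N j)) (G H Q : ℕ → Matrix (Fin N) (Fin N) (RatFun N j)) :
    Prop where
  map_zero : (mat N j 0).map δ = G 0 * mat N j 0 + mat N j 0 * (G 0).transpose
  map_succ : ∀ k : Fin j, (mat N j k.succ).map δ =
    G (k + 1) * mat N j k.succ + mat N j k.succ * H (k + 1)
  map_transpose : G 0 * (mat N j 0).transpose + (mat N j 0).transpose * (G 0).transpose =
    L * (mat N j 0).transpose + (mat N j 0).transpose * Q 0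
  compat : ∀ k : Fin j, mat N j k.succ * (Q k - H (k + 1)) =
    (G (k + 1) - (Q (k + 1)).transpose) * mat N j k.succ
  lower_L : IsLower L
  lower_G : ∀ k : Fin j, IsLower (G (k + 1))
  lower_H : ∀ k : Fin j, IsLower (H (k + 1))
  lower_Q : IsLower (Q j)

namespace ChainFlow

variable {N j : ℕ} {δ : Derivation ℂ (RatFun N j) (RatFun N j)}
  {L : Matrix (Fin N) (Fin N) (RatFun N j)} {G H Q : ℕ → Matrix (Fin N) (Fin N) (RatFun N j)}

/-- The multiplier is `Q m` after an even number of factors and `-(Q m)ᵀ` after an odd number. The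
single relation `compat` serves both parities: conjugated by `B⁻¹` it moves the multiplier past
`B⁻¹`, and transposed it moves it past `Bᵀ`. -/
theorem map_matS (h : ChainFlow N j δ L G H Q) :
    (matS N j).map δ = L * matS N j +
      matS N j * if Even j then Q j else -(Q j).transpose := by
  refine map_mul_prod_ofFn L j _ (fun m => if Even m then Q m else -(Q m).transpose) _ ?_ ?_
  · rw [Matrix.transpose_map, h.map_zero]
    simp only [Even.zero, if_true, Matrix.transpose_add, Matrix.transpose_mul,
      Matrix.transpose_transpose]
    rw [← h.map_transpose, add_comm]
  · intro k
    have hu := isUnit_mat_det N j k.succ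
    have hc := h.compat k
    have hs := h.map_succ k
    set B := mat N j k.succ
    by_cases hk : Even k.val
    · simp only [hk, if_true, Nat.even_add_one, not_true_eq_false, if_false]
      rw [map_inv_derivation δ B hu, hs]
      have h1 : (Q k - H (k + 1)) * B⁻¹ = B⁻¹ * (G (k + 1) - (Q (k + 1)).transpose) := by
        calc (Q k - H (k + 1)) * B⁻¹ = B⁻¹ * (B * (Q k - H (k + 1))) * B⁻¹ := by
              rw [Matrix.nonsing_inv_mul_cancel_left _ _ hu]
          _ = _ := by rw [hc, Matrix.mul_assoc, Matrix.mul_nonsing_inv_cancel_right _ _ hu]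
      have h2 : B⁻¹ * (G (k + 1) * B + B * H (k + 1)) * B⁻¹ =
          B⁻¹ * G (k + 1) + H (k + 1) * B⁻¹ := by
        rw [Matrix.mul_add, Matrix.add_mul, Matrix.nonsing_inv_mul_cancel_left _ _ hu,
          ← Matrix.mul_assoc, Matrix.mul_nonsing_inv_cancel_right _ _ hu]
      rw [h2, Matrix.mul_neg]
      rw [Matrix.sub_mul, Matrix.mul_sub] at h1
      rw [← sub_eq_zero] at h1 ⊢
      rw [← h1]
      abel
    · simp only [hk, if_false, Nat.even_add_one, not_false_eq_true, if_true]
      rw [Matrix.transpose_map, hs]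
      have h1 := congrArg Matrix.transpose hc
      simp only [Matrix.transpose_mul, Matrix.transpose_sub, Matrix.transpose_transpose,
        Matrix.transpose_add] at h1 ⊢
      rw [Matrix.sub_mul, Matrix.mul_sub] at h1
      rw [Matrix.neg_mul]
      rw [eq_comm] at h1
      rw [← sub_eq_zero] at h1 ⊢
      rw [← h1]
      abel

theorem isEigen_urMinor_mat (h : ChainFlow N j δ L G H Q) (k : Fin j) (p : ℕ) (hp : p ≤ N) :
    IsEigen δ (urMinor (mat N j k.succ) p hp)
      (headTrace (G (k + 1)) p hp + tailTrace (H (k + 1)) p hp) :=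
  isEigen_urMinor (h.map_succ k) (h.lower_G k) (h.lower_H k) p hp

theorem isEigen_det_zero (h : ChainFlow N j δ L G H Q) :
    IsEigen δ (mat N j 0).det (2 * (G 0).trace) := by
  rw [two_mul]
  nth_rw 2 [← Matrix.trace_transpose]
  exact derivation_det_of_map_eq δ h.map_zero

theorem isEigen_det_succ (h : ChainFlow N j δ L G H Q) (k : Fin j) :
    IsEigen δ (mat N j k.succ).det ((G (k + 1)).trace + (H (k + 1)).trace) :=
  derivation_det_of_map_eq δ (h.map_succ k)

theorem isEigen_urMinor_matS (h : ChainFlow N j δ L G H Q) (hj : Even j) (p : ℕ) (hp : p ≤ N) :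
    IsEigen δ (urMinor (matS N j) p hp) (headTrace L p hp + tailTrace (Q j) p hp) := by
  have h1 := h.map_matS
  rw [if_pos hj] at h1
  exact isEigen_urMinor h1 h.lower_L h.lower_Q p hp

theorem isEigen_ulMinor_matS (h : ChainFlow N j δ L G H Q) (hj : ¬ Even j) (p : ℕ)
    (hp : p ≤ N) :
    IsEigen δ (ulMinor (matS N j) p hp) (headTrace L p hp - headTrace (Q j) p hp) := by
  have h1 := h.map_matS
  rw [if_neg hj] at h1
  have h2 : headTrace L p hp - headTrace (Q j) p hp =
      headTrace L p hp + headTrace (-(Q j).transpose) p hp := by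
    simp [headTrace, sub_eq_add_neg]
  rw [h2]
  refine isEigen_ulMinor h1 h.lower_L ?_ p hp
  rw [Matrix.transpose_neg, Matrix.transpose_transpose]
  exact h.lower_Q.neg

/-- The eigenvalue of `M_S^p ∏ M_{B_k}^p` for an even chain. -/
def evenWeight (L : Matrix (Fin N) (Fin N) (RatFun N j))
    (G H Q : ℕ → Matrix (Fin N) (Fin N) (RatFun N j)) (p : ℕ) (hp : p ≤ N) : RatFun N j :=
  headTrace L p hp + tailTrace (Q j) p hp +
    ∑ k ∈ Finset.range j, (headTrace (G (k + 1)) p hp + tailTrace (H (k + 1)) p hp)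

theorem isEigen_casimirXEven (h : ChainFlow N j δ L G H Q) (hj : Even j)
    (p : Fin ((N + 1) / 2)) :
    IsEigen δ (casimirXEven N j p)
      (evenWeight L G H Q p.val (by omega) - evenWeight L G H Q (N - p.val) (Nat.sub_le _ _)) := by
  simp only [evenWeight, Finset.sum_range]
  exact ((h.isEigen_urMinor_matS hj _ _).mul
    (IsEigen.prod fun k _ => h.isEigen_urMinor_mat k _ _)).div
    ((h.isEigen_urMinor_matS hj _ _).mul
      (IsEigen.prod fun k _ => h.isEigen_urMinor_mat k _ _))

/-- The eigenvalue of `M_B^p M_B^{N-p}` for a single member `B` of the chain. -/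
def minorWeight (G H : Matrix (Fin N) (Fin N) (RatFun N j)) (p : ℕ) (hp : p ≤ N) : RatFun N j :=
  headTrace G p hp + tailTrace H p hp +
    (headTrace G (N - p) (Nat.sub_le _ _) + tailTrace H (N - p) (Nat.sub_le _ _))

end ChainFlow

/-- The eigenvalue of `X_p` for a chain of odd length. -/
def oddWeight {N r : ℕ} (L : Matrix (Fin N) (Fin N) (RatFun N (2 * r + 1)))
    (G H Q : ℕ → Matrix (Fin N) (Fin N) (RatFun N (2 * r + 1))) (p : ℕ) (hp : p ≤ N) :
    RatFun N (2 * r + 1) :=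
  headTrace L p hp - headTrace (Q (2 * r + 1)) p hp +
      (headTrace L (N - p) (Nat.sub_le _ _) -
        headTrace (Q (2 * r + 1)) (N - p) (Nat.sub_le _ _)) +
    ∑ k ∈ Finset.range r, ChainFlow.minorWeight (G (2 * k + 2)) (H (2 * k + 2)) p hp -
    ∑ k ∈ Finset.range (r + 1), ChainFlow.minorWeight (G (2 * k + 1)) (H (2 * k + 1)) p hp +
    (∑ k ∈ Finset.range (r + 1), 2 * ((G (2 * k + 1)).trace + (H (2 * k + 1)).trace) -
      (2 * (G 0).trace +
        ∑ k ∈ Finset.range r, 2 * ((G (2 * k + 2)).trace + (H (2 * k + 2)).trace)))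

theorem ChainFlow.isEigen_casimirXOdd {N r : ℕ}
    {δ : Derivation ℂ (RatFun N (2 * r + 1)) (RatFun N (2 * r + 1))}
    {L : Matrix (Fin N) (Fin N) (RatFun N (2 * r + 1))}
    {G H Q : ℕ → Matrix (Fin N) (Fin N) (RatFun N (2 * r + 1))}
    (h : ChainFlow N (2 * r + 1) δ L G H Q) (p : Fin (N / 2)) :
    IsEigen δ (casimirXOdd N r p) (oddWeight L G H Q (p.val + 1) (by omega)) := by
  have hj : ¬ Even (2 * r + 1) := by simp
  have hodd : ∀ k : Fin (r + 1), (⟨2 * k.val + 1, by omega⟩ : Fin (2 * r + 1 + 1)) =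
      Fin.succ ⟨2 * k.val, by omega⟩ := fun k => rfl
  have hev : ∀ k : Fin r, (⟨2 * (k.val + 1), by omega⟩ : Fin (2 * r + 1 + 1)) =
      Fin.succ ⟨2 * k.val + 1, by omega⟩ := fun k => rfl
  simp only [oddWeight, Finset.sum_range, casimirXOdd, hodd, hev]
  refine (((h.isEigen_ulMinor_matS hj _ _).mul (h.isEigen_ulMinor_matS hj _ _)).mul
    (IsEigen.prod fun k _ => ?_)).div (IsEigen.prod fun k _ => ?_) |>.mul
      ((IsEigen.prod fun k _ => ?_).div (h.isEigen_det_zero.mul (IsEigen.prod fun k _ => ?_)))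
  · exact (h.isEigen_urMinor_mat _ _ _).mul (h.isEigen_urMinor_mat _ _ _)
  · exact (h.isEigen_urMinor_mat _ _ _).mul (h.isEigen_urMinor_mat _ _ _)
  · exact (h.isEigen_det_succ _).sq
  · exact (h.isEigen_det_succ _).sq

/-! ### The brackets in components, and the elementary triangular multipliers. -/

section Components

variable {N : ℕ} {K : Type*} [Field K]

theorem rMat_apply (a c b d : Fin N) :
    rMat N K (a, c) (b, d) = if b = c ∧ d = a then 2 * theta N K a c else 0 := by
  simp only [rMat, Matrix.sum_apply, Matrix.smul_apply, Matrix.kroneckerMap_apply, smul_eq_mul,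
    Matrix.single_apply]
  rw [Finset.sum_eq_single a, Finset.sum_eq_single c]
  · by_cases h1 : c = b <;> by_cases h2 : a = d <;> simp [h1, h2, eq_comm]
  · intro e _ he
    simp [he]
  · simp
  · intro e _ he
    exact Finset.sum_eq_zero fun _ _ => by simp [he]
  · simp

theorem transpose₁_rMat_apply (a c b d : Fin N) :
    transpose₁ (rMat N K) (a, c) (b, d) = if a = c ∧ b = d then 2 * theta N K b c else 0 := by
  simp only [transpose₁, Matrix.of_apply, rMat_apply]
  exact if_congr (and_congr_right fun _ => eq_comm) rfl rfl

theorem QMat_apply (a c b d : Fin N) :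
    QMat N K (a, c) (b, d) = if a = c ∧ b = d then -(2 * theta N K a d) else 0 := by
  simp only [QMat, transpose₂, Matrix.neg_apply, Matrix.of_apply, rMat_apply]
  by_cases h1 : a = c <;> by_cases h2 : b = d <;> simp [h1, h2, eq_comm]

theorem bracketBB_apply (B : Matrix (Fin N) (Fin N) K) (a c b d : Fin N) :
    bracketBB B (a, c) (b, d) =
      2 * theta N K a c * B a d * B c b - 2 * theta N K d b * B a d * B c b := by
  simp only [bracketBB, Matrix.sub_apply, Matrix.mul_apply, Fintype.sum_prod_type, rMat_apply,
    Matrix.kroneckerMap_apply, ite_and, ite_mul, mul_ite, zero_mul, mul_zero,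
    Finset.sum_ite_eq, Finset.sum_ite_eq', Finset.mem_univ, if_true,
    Finset.sum_ite_irrel, Finset.sum_const_zero]
  ring

theorem bracketNext_apply (B' B : Matrix (Fin N) (Fin N) K) (a c b d : Fin N) :
    bracketNext B' B (a, c) (b, d) = -(2 * theta N K c b * B' a c * B b d) := by
  simp only [bracketNext, inFirst, inSecond, Matrix.mul_apply, Fintype.sum_prod_type, QMat_apply,
    Matrix.kroneckerMap_apply, Matrix.one_apply, ite_and, ite_mul, mul_ite, zero_mul, mul_zero,
    Finset.sum_ite_eq, Finset.sum_ite_eq', Finset.mem_univ, if_true, mul_one, one_mul,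
    Finset.sum_ite_irrel, Finset.sum_const_zero]
  ring

theorem bracketBA_apply (B A : Matrix (Fin N) (Fin N) K) (a c b d : Fin N) :
    bracketBA B A (a, c) (b, d) =
      -(2 * theta N K c b * B a c * A b d) - 2 * theta N K d b * B a d * A c b := by
  rw [bracketBA, Matrix.add_apply, sub_eq_add_neg]
  congr 1
  · exact bracketNext_apply B A a c b d
  · simp only [QMat, transpose₂, inFirst, inSecond, Matrix.mul_apply, Fintype.sum_prod_type,
      rMat_apply, Matrix.of_apply, Matrix.neg_apply,
      Matrix.kroneckerMap_apply, Matrix.one_apply, ite_and, ite_mul, mul_ite, zero_mul, mul_zero,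
      Finset.sum_ite_eq, Finset.sum_ite_eq', Finset.mem_univ, if_true, mul_one, one_mul, mul_neg,
      Finset.sum_neg_distrib,
      Finset.sum_ite_irrel, Finset.sum_const_zero]
    ring

theorem bracketAA_apply (A : Matrix (Fin N) (Fin N) K) (a c b d : Fin N) :
    bracketAA A (a, c) (b, d) =
      2 * theta N K a c * A a d * A c b - 2 * theta N K d b * A a d * A c b +
        2 * theta N K b c * A a c * A b d - 2 * theta N K d a * A c a * A d b := by
  rw [bracketAA, Matrix.sub_apply, Matrix.add_apply]
  congr 1
  · congr 1
    · exact bracketBB_apply A a c b d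
    · simp only [inFirst, inSecond, Matrix.mul_apply, Fintype.sum_prod_type,
        transpose₁_rMat_apply,
        Matrix.kroneckerMap_apply, Matrix.one_apply, ite_and, ite_mul, mul_ite, zero_mul,
        mul_zero, Finset.sum_ite_eq, Finset.sum_ite_eq', Finset.mem_univ, if_true, mul_one,
        one_mul, Finset.sum_ite_irrel, Finset.sum_const_zero]
      ring
  · simp only [inFirst, inSecond, Matrix.mul_apply, Fintype.sum_prod_type,
      transpose₁_rMat_apply,
      Matrix.kroneckerMap_apply, Matrix.one_apply, ite_and, ite_mul, mul_ite, zero_mul,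
      mul_zero, Finset.sum_ite_eq, Finset.sum_ite_eq', Finset.mem_univ, if_true, mul_one,
      one_mul, Finset.sum_ite_irrel, Finset.sum_const_zero]
    ring

/-- `2 ∑ θ(a - c) v_a E_{ac}`. -/
def lowCol (c : Fin N) (v : Fin N → K) : Matrix (Fin N) (Fin N) K :=
  Matrix.of fun a b => if b = c then 2 * theta N K a c * v a else 0

/-- `2 ∑ θ(d - b) v_b E_{db}`. -/
def lowRow (d : Fin N) (v : Fin N → K) : Matrix (Fin N) (Fin N) K :=
  Matrix.of fun a b => if a = d then 2 * theta N K d b * v b else 0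

theorem theta_of_lt {a b : Fin N} (h : a < b) : theta N K a b = 0 := by
  simp [theta, h.le, h.ne, not_lt]

theorem isLower_lowCol (c : Fin N) (v : Fin N → K) : IsLower (lowCol c v) := by
  intro a b h
  simp only [lowCol, Matrix.of_apply]
  split_ifs with hb
  · subst hb
    simp [theta_of_lt h]
  · rfl

theorem isLower_lowRow (c : Fin N) (v : Fin N → K) : IsLower (lowRow c v) := by
  intro a b h
  simp only [lowRow, Matrix.of_apply]
  split_ifs with hb
  · subst hb
    simp [theta_of_lt h]
  · rfl

theorem lowCol_mul_apply (c : Fin N) (v : Fin N → K) (X : Matrix (Fin N) (Fin N) K)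
    (a b : Fin N) : (lowCol c v * X) a b = 2 * theta N K a c * v a * X c b := by
  simp [lowCol, Matrix.mul_apply]

theorem mul_lowRow_apply (d : Fin N) (v : Fin N → K) (X : Matrix (Fin N) (Fin N) K)
    (a b : Fin N) : (X * lowRow d v) a b = X a d * (2 * theta N K d b * v b) := by
  simp [lowRow, Matrix.mul_apply]

theorem mul_lowCol_transpose_apply (c : Fin N) (v : Fin N → K) (X : Matrix (Fin N) (Fin N) K)
    (a b : Fin N) : (X * (lowCol c v).transpose) a b = X a c * (2 * theta N K b c * v b) := by
  simp [lowCol, Matrix.mul_apply]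

theorem lowRow_transpose_mul_apply (d : Fin N) (v : Fin N → K) (X : Matrix (Fin N) (Fin N) K)
    (a b : Fin N) :
    ((lowRow d v).transpose * X) a b = 2 * theta N K d a * v a * X d b := by
  simp [lowRow, Matrix.mul_apply]

variable [CharZero K]

theorem two_mul_theta_self (a : Fin N) : 2 * theta N K a a = 1 := by
  simp [theta]

theorem theta_add_theta (a b : Fin N) : theta N K a b + theta N K b a = 1 := by
  rcases lt_trichotomy a b with h | rfl | h
  · simp [theta, h, h.ne, not_lt.2 h.le]
  · linear_combination two_mul_theta_self (K := K) a
  · simp [theta, h, h.ne, not_lt.2 h.le]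

theorem lowCol_diag (c : Fin N) (v : Fin N → K) (a : Fin N) :
    lowCol c v a a = if a = c then v c else 0 := by
  simp only [lowCol, Matrix.of_apply]
  split_ifs with h
  · rw [h, two_mul_theta_self, one_mul]
  · rfl

theorem lowRow_diag (c : Fin N) (v : Fin N → K) (a : Fin N) :
    lowRow c v a a = if a = c then v c else 0 := by
  simp only [lowRow, Matrix.of_apply]
  split_ifs with h
  · rw [h, two_mul_theta_self, one_mul]
  · rfl

end Components

/-! ### Brackets with coordinate functions as chain flows. -/

/-- The derivation `{·, u}` for a coordinate function `u`. -/
def bracketDerivation (N j : ℕ) (v : Idx N j) : Derivation ℂ (RatFun N j) (RatFun N j) :=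
  ∑ u, structureFun N j u v • partialDeriv N j u

theorem bracketDerivation_apply (N j : ℕ) (v : Idx N j) (f : RatFun N j) :
    bracketDerivation N j v f = ∑ u, structureFun N j u v * partialDeriv N j u f := by
  simp only [bracketDerivation, ← Derivation.coeFnAddMonoidHom_apply, map_sum, Finset.sum_apply]
  rfl

theorem isCasimir_of_bracketDerivation {N j : ℕ} {f : RatFun N j}
    (h : ∀ v, bracketDerivation N j v f = 0) : IsCasimir N j f := by
  intro g
  rw [bracket, Finset.sum_comm]
  refine Finset.sum_eq_zero fun v _ => ?_
  rw [← Finset.sum_mul, ← bracketDerivation_apply, h, zero_mul]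

theorem sum_smul_partialDeriv_coord {N j : ℕ} (s : Idx N j → RatFun N j) (u : Idx N j) :
    (∑ w, s w * partialDeriv N j w (coord N j u)) = s u := by
  rw [Finset.sum_eq_single u]
  · simp [coord, partialDeriv_algebraMap]
  · intro w _ hw
    simp [coord, partialDeriv_algebraMap, MvPolynomial.pderiv_X, Pi.single_eq_of_ne (Ne.symm hw)]
  · simp

theorem bracketDerivation_mat_apply (N j : ℕ) (v : Idx N j) (k : Fin (j + 1)) (a b : Fin N) :
    ((mat N j k).map (bracketDerivation N j v)) a b = structureFun N j (k, a, b) v := by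
  rw [Matrix.map_apply, bracketDerivation_apply]
  exact sum_smul_partialDeriv_coord (fun u => structureFun N j u v) (k, a, b)

/-- Left multiplications generated by an entry `(c, d)` of `M = B_l`. -/
def succG {N : ℕ} {K : Type*} [Field K] (M : Matrix (Fin N) (Fin N) K) (l : ℕ) (c d : Fin N)
    (k : ℕ) : Matrix (Fin N) (Fin N) K :=
  if k = l then lowCol c (fun a => M a d) else if k + 1 = l then lowCol d (M c) else 0

/-- Right multiplications generated by an entry `(c, d)` of `M = B_l`. -/
def succH {N : ℕ} {K : Type*} [Field K] (M : Matrix (Fin N) (Fin N) K) (l : ℕ) (c d : Fin N)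
    (k : ℕ) : Matrix (Fin N) (Fin N) K :=
  if k = l then -lowRow d (M c) else if k = l + 1 then -lowRow c (fun a => M a d) else 0

/-- Right multiplications of the partial products of `S` generated by an entry `(c, d)` of
`M = B_l`. -/
def succQ {N : ℕ} {K : Type*} [Field K] (M : Matrix (Fin N) (Fin N) K) (l : ℕ) (c d : Fin N)
    (k : ℕ) : Matrix (Fin N) (Fin N) K :=
  if k = l then -lowRow c (fun a => M a d) else
    if k + 1 = l then (lowCol d (M c)).transpose else 0

/-- Left multiplication of `S` generated by an entry `(c, d)` of `M = B_l`. -/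
def succL {N : ℕ} {K : Type*} [Field K] (M : Matrix (Fin N) (Fin N) K) (l : ℕ) (c d : Fin N) :
    Matrix (Fin N) (Fin N) K :=
  if l = 1 then lowCol d (M c) else 0

/-- An entry of a matrix `B` of the chain moves only `B` and its neighbours. `succQ` is chosen so
that `compat` holds trivially at all other matrices, leaving one genuine identity at `B` itself. -/
theorem chainFlow_succ (N j : ℕ) (l : Fin j) (c d : Fin N) :
    ChainFlow N j (bracketDerivation N j (l.succ, c, d)) (succL (mat N j l.succ) (l + 1) c d)
      (succG (mat N j l.succ) (l + 1) c d) (succH (mat N j l.succ) (l + 1) c d)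
      (succQ (mat N j l.succ) (l + 1) c d) where
  map_zero := by
    ext a b
    rw [bracketDerivation_mat_apply]
    simp only [structureFun, succG, bracketStep, Fin.ext_iff, Fin.val_zero, Fin.val_succ]
    split_ifs <;> first
      | contradiction
      | exact absurd ‹_› (Fin.succ_ne_zero _)
      | omega
      | (simp only [Matrix.add_apply, bracketBA_apply, lowCol_mul_apply,
          mul_lowCol_transpose_apply]
         ring1)
      | simp
  map_succ k := by
    ext a b
    rw [bracketDerivation_mat_apply]
    by_cases h1 : k = l
    · subst h1
      simp only [structureFun, succG, succH, Fin.succ_ne_zero, if_false, if_true,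
        bracketBB_apply, Matrix.add_apply, lowCol_mul_apply, Matrix.mul_neg,
        Matrix.neg_apply, mul_lowRow_apply]
      ring
    · have h2 : (k : ℕ) ≠ l := fun h => h1 (Fin.ext h)
      simp only [structureFun, succG, succH, bracketStep, Fin.ext_iff,
        Fin.val_zero, Fin.val_succ]
      split_ifs <;> first
        | contradiction
        | exact absurd ‹_› (Fin.succ_ne_zero _)
        | omega
        | (simp only [bracketNext_apply, Matrix.add_apply, Matrix.zero_mul, Matrix.mul_zero,
            Matrix.zero_apply, Matrix.mul_neg, Matrix.neg_apply, mul_lowRow_apply,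
            lowCol_mul_apply]
           ring1)
  map_transpose := by
    simp only [succG, succQ, succL]
    split_ifs <;> first
      | contradiction
      | exact absurd ‹_› (Fin.succ_ne_zero _)
      | omega
      | simp
  compat k := by
    by_cases h1 : k = l
    · subst h1
      simp only [succG, succQ, succH, if_true]
      rw [if_neg (by omega)]
      ext a b
      simp only [Matrix.transpose_neg, sub_neg_eq_add, Matrix.mul_add, Matrix.add_mul,
        Matrix.add_apply, mul_lowCol_transpose_apply, mul_lowRow_apply, lowCol_mul_apply,
        lowRow_transpose_mul_apply]
      -- With `B = mat N j k.succ`, both sides equal `2 B_{ad} B_{cb}`, the two step functions on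
      -- each side adding up to `1`.
      linear_combination 2 * mat N j k.succ a d * mat N j k.succ c b *
        (theta_add_theta (K := RatFun N j) b d - theta_add_theta (K := RatFun N j) a c)
    · have h2 : (k : ℕ) ≠ l := fun h => h1 (Fin.ext h)
      simp only [succG, succQ, succH]
      split_ifs <;> first
        | contradiction
        | exact absurd ‹_› (Fin.succ_ne_zero _)
        | omega
        | simp
  lower_L := by
    unfold succL
    split_ifs
    · exact isLower_lowCol _ _
    · exact IsLower.zero
  lower_G k := by
    unfold succG
    split_ifs
    · exact isLower_lowCol _ _
    · exact isLower_lowCol _ _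
    · exact IsLower.zero
  lower_H k := by
    unfold succH
    split_ifs
    · exact (isLower_lowRow _ _).neg
    · exact (isLower_lowRow _ _).neg
    · exact IsLower.zero
  lower_Q := by
    unfold succQ
    split_ifs
    · exact (isLower_lowRow _ _).neg
    · omega
    · exact IsLower.zero

/-- The left multiplier of `A` has an upper triangular part, which is harmless because only `det A`
and the pencil of `A` are used. On `Aᵀ` this part is traded between the two sides, giving lower
triangular `L` and `Q 0`; the latter equals the right multiplier of `B₁`. -/
theorem chainFlow_zero (N j : ℕ) (c d : Fin N) :
    ChainFlow N j (bracketDerivation N j (0, c, d))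
      (lowCol c (fun a => mat N j 0 a d) + lowCol d (mat N j 0 c))
      (fun k => if k = 0 then
        lowCol c (fun a => mat N j 0 a d) - (lowRow d (mat N j 0 c)).transpose else 0)
      (fun k => if k = 1 then
        -(lowRow c (fun a => mat N j 0 a d) + lowRow d (mat N j 0 c)) else 0)
      (fun k => if k = 0 then
        -(lowRow c (fun a => mat N j 0 a d) + lowRow d (mat N j 0 c)) else 0) where
  map_zero := by
    ext a b
    rw [bracketDerivation_mat_apply]
    simp only [structureFun, if_true, bracketAA_apply, Matrix.transpose_sub,
      Matrix.transpose_transpose, Matrix.sub_mul, Matrix.mul_sub, Matrix.add_apply,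
      Matrix.sub_apply, lowCol_mul_apply, lowRow_transpose_mul_apply, mul_lowRow_apply,
      mul_lowCol_transpose_apply]
    ring
  map_succ k := by
    ext a b
    rw [bracketDerivation_mat_apply]
    simp only [structureFun, bracketStep, Fin.ext_iff, Fin.val_zero, Fin.val_succ]
    split_ifs <;> first
      | contradiction
      | exact absurd ‹_› (Fin.succ_ne_zero _)
      | omega
      | (simp only [bracketBA_apply, Matrix.mul_neg, Matrix.mul_add, Matrix.zero_mul,
          Matrix.zero_apply, Matrix.neg_apply, Matrix.add_apply, mul_lowRow_apply]
         ring1)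
      | simp
  map_transpose := by
    simp only [if_true]
    ext a b
    simp only [Matrix.transpose_sub, Matrix.transpose_transpose, Matrix.mul_sub, Matrix.sub_mul,
      Matrix.mul_add, Matrix.add_mul, Matrix.mul_neg, Matrix.neg_apply, Matrix.add_apply,
      Matrix.sub_apply, mul_lowCol_transpose_apply, mul_lowRow_apply, lowCol_mul_apply,
      lowRow_transpose_mul_apply, Matrix.transpose_apply]
    -- The trade costs `2 A_{ca} A_{bd}` on either side, again by `θ(x) + θ(-x) = 1`.
    linear_combination 2 * mat N j 0 c a * mat N j 0 b d *
      (theta_add_theta (K := RatFun N j) b c - theta_add_theta (K := RatFun N j) a d)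
  compat k := by
    by_cases hk : k.val = 0 <;> simp [hk]
  lower_L := (isLower_lowCol _ _).add (isLower_lowCol _ _)
  lower_G k := by simpa using IsLower.zero
  lower_H k := by
    split_ifs
    · exact ((isLower_lowRow _ _).add (isLower_lowRow _ _)).neg
    · exact IsLower.zero
  lower_Q := by
    split_ifs
    · exact ((isLower_lowRow _ _).add (isLower_lowRow _ _)).neg
    · exact IsLower.zero

/-! ### Bookkeeping of partial traces. -/

section Traces

variable {N : ℕ} {K : Type*} [Field K]

theorem headTrace_zero (p : ℕ) (hp : p ≤ N) :
    headTrace (0 : Matrix (Fin N) (Fin N) K) p hp = 0 := by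
  simp [headTrace]

theorem tailTrace_zero (p : ℕ) (hp : p ≤ N) :
    tailTrace (0 : Matrix (Fin N) (Fin N) K) p hp = 0 := by
  simp [tailTrace]

theorem headTrace_add (G H : Matrix (Fin N) (Fin N) K) (p : ℕ) (hp : p ≤ N) :
    headTrace (G + H) p hp = headTrace G p hp + headTrace H p hp := by
  simp [headTrace, Finset.sum_add_distrib]

theorem tailTrace_add (G H : Matrix (Fin N) (Fin N) K) (p : ℕ) (hp : p ≤ N) :
    tailTrace (G + H) p hp = tailTrace G p hp + tailTrace H p hp := by
  simp [tailTrace, Finset.sum_add_distrib]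

theorem headTrace_neg (G : Matrix (Fin N) (Fin N) K) (p : ℕ) (hp : p ≤ N) :
    headTrace (-G) p hp = -headTrace G p hp := by
  simp [headTrace]

theorem tailTrace_neg (G : Matrix (Fin N) (Fin N) K) (p : ℕ) (hp : p ≤ N) :
    tailTrace (-G) p hp = -tailTrace G p hp := by
  simp [tailTrace]

theorem trace_of_diag {G : Matrix (Fin N) (Fin N) K} {x : K} {c : Fin N}
    (hG : ∀ a, G a a = if a = c then x else 0) : G.trace = x := by
  simp [Matrix.trace, hG]

/-- Writing a tail as the full trace minus a complementary head expresses all weights through cuts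
at `p` and `N - p`. -/
theorem tailTrace_eq_of_diag {G : Matrix (Fin N) (Fin N) K} {x : K} {c : Fin N}
    (hG : ∀ a, G a a = if a = c then x else 0) (p : ℕ) (hp : p ≤ N) :
    tailTrace G p hp = x - if c.val < N - p then x else 0 := by
  rw [tailTrace_of_diag hG]
  split_ifs <;> first
    | omega
    | simp

theorem sum_range_two_mul_add (n s l : ℕ) (x : K) :
    (∑ k ∈ Finset.range n, if 2 * k + s = l then x else 0) =
      if s ≤ l ∧ l < 2 * n + s ∧ (l - s) % 2 = 0 then x else 0 := by
  split_ifs with h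
  · rw [Finset.sum_eq_single ((l - s) / 2)]
    · rw [if_pos (by omega)]
    · intro k _ hk
      rw [if_neg (by omega)]
    · intro hk
      rw [Finset.mem_range] at hk
      omega
  · refine Finset.sum_eq_zero fun k hk => if_neg ?_
    rw [Finset.mem_range] at hk
    omega

theorem sum_range_add (n s l : ℕ) (x : K) :
    (∑ k ∈ Finset.range n, if k + s = l then x else 0) =
      if s ≤ l ∧ l < n + s then x else 0 := by
  split_ifs with h
  · rw [Finset.sum_eq_single (l - s)]
    · rw [if_pos (by omega)]
    · intro k _ hk
      rw [if_neg (by omega)]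
    · intro hk
      rw [Finset.mem_range] at hk
      omega
  · refine Finset.sum_eq_zero fun k hk => if_neg ?_
    rw [Finset.mem_range] at hk
    omega

end Traces

section Weights

variable {N : ℕ} {K : Type*} [Field K] [CharZero K] (M : Matrix (Fin N) (Fin N) K) (l : ℕ)
  (c d : Fin N) (k : ℕ) (p : ℕ) (hp : p ≤ N)

/-- The contribution of a diagonal entry `x` at position `c` to the trace of the upper-left
`p × p` block. -/
def cut (x : K) (c p : ℕ) : K := if c < p then x else 0

theorem headTrace_lowCol (v : Fin N → K) : headTrace (lowCol c v) p hp = cut (v c) c p :=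
  headTrace_of_diag (lowCol_diag c v) p hp

theorem headTrace_lowRow (v : Fin N → K) : headTrace (lowRow c v) p hp = cut (v c) c p :=
  headTrace_of_diag (lowRow_diag c v) p hp

theorem tailTrace_lowRow (v : Fin N → K) :
    tailTrace (lowRow c v) p hp = v c - cut (v c) c (N - p) :=
  tailTrace_eq_of_diag (lowRow_diag c v) p hp

theorem headTrace_succG : headTrace (succG M l c d k) p hp =
    (if k = l then cut (M c d) c p else 0) + if k + 1 = l then cut (M c d) d p else 0 := by
  unfold succG
  split_ifs <;> first
    | omega
    | simp [headTrace_lowCol, headTrace_zero]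

theorem tailTrace_succH : tailTrace (succH M l c d k) p hp =
    -(if k = l then M c d - cut (M c d) d (N - p) else 0) -
      if k = l + 1 then M c d - cut (M c d) c (N - p) else 0 := by
  unfold succH
  split_ifs <;> first
    | omega
    | simp [tailTrace_neg, tailTrace_lowRow, tailTrace_zero]

theorem trace_succG : (succG M l c d k).trace =
    (if k = l then M c d else 0) + if k + 1 = l then M c d else 0 := by
  unfold succG
  split_ifs <;> first
    | omega
    | simp [trace_of_diag (lowCol_diag _ _)]

theorem trace_succH : (succH M l c d k).trace =
    -(if k = l then M c d else 0) - if k = l + 1 then M c d else 0 := by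
  unfold succH
  split_ifs <;> first
    | omega
    | simp [trace_of_diag (lowRow_diag _ _)]

theorem headTrace_succL : headTrace (succL M l c d) p hp =
    if l = 1 then cut (M c d) d p else 0 := by
  unfold succL
  split_ifs <;> simp [headTrace_lowCol, headTrace_zero]

end Weights

/-! ### Cancellation of weights: the `X_p` are Casimir functions. -/

/-- The point is the symmetry of the right-hand side under `p ↔ N - p`. A missing neighbour at
either end of the chain is replaced by the contribution of `L` or `Q j` from `M_S^p`. -/
theorem evenWeight_succ (N j : ℕ) (l : Fin j) (c d : Fin N) (p : ℕ) (hp : p ≤ N)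
    (x : RatFun N j) (M : Matrix (Fin N) (Fin N) (RatFun N j)) (hx : M c d = x) :
    ChainFlow.evenWeight (succL M (l + 1) c d) (succG M (l + 1) c d) (succH M (l + 1) c d)
      (succQ M (l + 1) c d) p hp =
      cut x c p + cut x d p + cut x c (N - p) + cut x d (N - p) - 2 * x := by
  have hQ : tailTrace (succQ M (l + 1) c d j) p hp =
      -if j = l + 1 then x - cut x c (N - p) else 0 := by
    unfold succQ
    split_ifs <;> first
      | omega
      | simp [tailTrace_neg, tailTrace_lowRow, tailTrace_zero, hx]
  have hl := l.isLt
  simp only [ChainFlow.evenWeight, headTrace_succL, headTrace_succG, tailTrace_succH, hQ,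
    Finset.sum_add_distrib, Finset.sum_sub_distrib, Finset.sum_neg_distrib, add_assoc, hx,
    sum_range_add, Nat.reduceAdd]
  split_ifs <;> first
    | omega
    | ring

theorem evenWeight_zero (N j : ℕ) (c d : Fin N) (p : ℕ) (hp : p ≤ N) :
    ChainFlow.evenWeight (lowCol c (fun a => mat N j 0 a d) + lowCol d (mat N j 0 c))
      (fun k => if k = 0 then
        lowCol c (fun a => mat N j 0 a d) - (lowRow d (mat N j 0 c)).transpose else 0)
      (fun k => if k = 1 then
        -(lowRow c (fun a => mat N j 0 a d) + lowRow d (mat N j 0 c)) else 0)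
      (fun k => if k = 0 then
        -(lowRow c (fun a => mat N j 0 a d) + lowRow d (mat N j 0 c)) else 0) p hp =
      cut (mat N j 0 c d) c p + cut (mat N j 0 c d) d p + cut (mat N j 0 c d) c (N - p) +
        cut (mat N j 0 c d) d (N - p) - 2 * mat N j 0 c d := by
  have hH : ∀ k : ℕ, tailTrace (if k = 0 then
      -(lowRow c (fun a => mat N j 0 a d) + lowRow d (mat N j 0 c)) else 0) p hp =
      if k + 0 = 0 then -(mat N j 0 c d - cut (mat N j 0 c d) c (N - p) +
        (mat N j 0 c d - cut (mat N j 0 c d) d (N - p))) else 0 := by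
    intro k
    rw [add_zero]
    split_ifs <;> simp [tailTrace_neg, tailTrace_add, tailTrace_lowRow, tailTrace_zero]
  simp only [ChainFlow.evenWeight, headTrace_add, headTrace_lowCol, hH, Nat.add_eq_zero_iff,
    one_ne_zero, and_false, if_false, headTrace_zero, Nat.add_eq_right, zero_add]
  have := sum_range_add (K := RatFun N j) j 0 0
  simp only [Nat.add_eq_zero_iff, and_true] at this
  rw [this]
  split_ifs <;> first
    | omega
    | ring

theorem isCasimir_casimirXEven (N j : ℕ) (hj : Even j) (p : Fin ((N + 1) / 2)) :
    IsCasimir N j (casimirXEven N j p) := by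
  have hp : N - (N - p.val) = p.val := by omega
  refine isCasimir_of_bracketDerivation fun v => ?_
  obtain ⟨l, c, d⟩ := v
  refine Fin.cases ?_ (fun l => ?_) l
  · rw [(chainFlow_zero N j c d).isEigen_casimirXEven hj p, evenWeight_zero, evenWeight_zero, hp]
    ring
  · rw [(chainFlow_succ N j l c d).isEigen_casimirXEven hj p,
      evenWeight_succ _ _ _ _ _ _ _ _ _ rfl, evenWeight_succ _ _ _ _ _ _ _ _ _ rfl, hp]
    ring

set_option maxHeartbeats 1000000 in
-- The cuts cancel between neighbours of opposite parity, or against `L` and `Q` at the ends; the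
-- remaining multiples of the entry are cancelled by the determinants.
theorem oddWeight_succ (N r : ℕ) (l : Fin (2 * r + 1)) (c d : Fin N) (p : ℕ) (hp : p ≤ N)
    (M : Matrix (Fin N) (Fin N) (RatFun N (2 * r + 1))) :
    oddWeight (succL M (l + 1) c d) (succG M (l + 1) c d) (succH M (l + 1) c d)
      (succQ M (l + 1) c d) p hp = 0 := by
  have hQ : ∀ q hq, headTrace (succQ M (l + 1) c d (2 * r + 1)) q hq =
      -if 2 * r + 1 = l + 1 then cut (M c d) c q else 0 := by
    intro q hq
    unfold succQ
    split_ifs <;> first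
      | omega
      | simp [headTrace_neg, headTrace_lowRow, headTrace_zero]
  have hl := l.isLt
  have hp' : N - (N - p) = p := by omega
  simp only [oddWeight, ChainFlow.minorWeight, headTrace_succL, headTrace_succG, tailTrace_succH,
    trace_succG, trace_succH, hQ, hp',
    Finset.sum_add_distrib, Finset.sum_sub_distrib, Finset.sum_neg_distrib, add_assoc,
    sum_range_two_mul_add, Nat.reduceAdd, ← Finset.mul_sum]
  -- The identity is linear in the four cuts and the entry, so these can be treated as free
  -- variables.
  generalize cut (M c d) c p = cp
  generalize cut (M c d) d p = dp
  generalize cut (M c d) c (N - p) = cq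
  generalize cut (M c d) d (N - p) = dq
  generalize M c d = x
  clear hQ hp' hp M p c d
  generalize l.val = l at *
  -- `l` counts from zero, so even `l` means a matrix of odd index; `m = 0` and `m = r` isolate the
  -- ends of the chain.
  rcases Nat.even_or_odd' l with ⟨m, hm | hm⟩ <;> by_cases h0 : m = 0 <;>
    by_cases h1 : m = r
  all_goals
    subst hm
    first | (exfalso; omega) | skip
    (repeat first
      | rw [if_pos (by omega)]
      | rw [if_neg (by omega)])
    try ring

theorem oddWeight_zero (N r : ℕ) (c d : Fin N) (p : ℕ) (hp : p ≤ N)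
    (A : Matrix (Fin N) (Fin N) (RatFun N (2 * r + 1))) :
    oddWeight (lowCol c (fun a => A a d) + lowCol d (A c))
      (fun k => if k = 0 then
        lowCol c (fun a => A a d) - (lowRow d (A c)).transpose else 0)
      (fun k => if k = 1 then
        -(lowRow c (fun a => A a d) + lowRow d (A c)) else 0)
      (fun k => if k = 0 then
        -(lowRow c (fun a => A a d) + lowRow d (A c)) else 0) p hp = 0 := by
  have hH : ∀ k q hq, tailTrace (if 2 * k = 0 then
      -(lowRow c (fun a => A a d) + lowRow d (A c)) else 0) q hq =
      if 2 * k = 0 then -(A c d - cut (A c d) c (N - q) +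
        (A c d - cut (A c d) d (N - q))) else 0 := by
    intro k q hq
    split_ifs <;> simp [tailTrace_neg, tailTrace_add, tailTrace_lowRow, tailTrace_zero]
  have hT : ∀ k : ℕ, (if 2 * k = 0 then
      -(lowRow c (fun a => A a d) + lowRow d (A c)) else 0).trace =
      if 2 * k = 0 then -(A c d + A c d) else 0 := by
    intro k
    split_ifs <;> simp [trace_of_diag (lowRow_diag _ _)]
  have hp' : N - (N - p) = p := by omega
  have hs : ∀ x : RatFun N (2 * r + 1),
      (∑ k ∈ Finset.range (r + 1), if 2 * k = 0 then x else 0) = x := fun x => by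
    rw [Finset.sum_eq_single_of_mem 0 (by simp) fun k _ hk => if_neg (by omega)]
    simp
  have h1 : ∀ k, 2 * k + 2 ≠ 1 := fun k => by omega
  simp only [oddWeight, ChainFlow.minorWeight, headTrace_add, headTrace_lowCol, hH, hT,
    Nat.add_eq_zero_iff, one_ne_zero, and_false, if_false, headTrace_zero, tailTrace_zero,
    Nat.add_eq_right, zero_add, h1, two_ne_zero, hp', Matrix.trace_zero, if_true,
    Matrix.trace_sub, Matrix.trace_transpose, trace_of_diag (lowCol_diag _ _),
    trace_of_diag (lowRow_diag _ _), Finset.sum_add_distrib, ← Finset.mul_sum,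
    hs, Finset.sum_const_zero]
  ring

theorem isCasimir_casimirXOdd (N r : ℕ) (p : Fin (N / 2)) :
    IsCasimir N (2 * r + 1) (casimirXOdd N r p) := by
  refine isCasimir_of_bracketDerivation fun v => ?_
  obtain ⟨l, c, d⟩ := v
  refine Fin.cases ?_ (fun l => ?_) l
  · rw [(chainFlow_zero N (2 * r + 1) c d).isEigen_casimirXOdd p, oddWeight_zero, zero_mul]
  · rw [(chainFlow_succ N (2 * r + 1) l c d).isEigen_casimirXOdd p, oddWeight_succ, zero_mul]

/-! ### The palindromic pencil `det (X A + Aᵀ)` and the expansion defining `Y_p`. -/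

section Pencil

variable {N : ℕ} {R : Type*} [CommRing R]

/-- The polynomial `det (X A + Aᵀ)`. -/
def pencilPoly (A : Matrix (Fin N) (Fin N) R) : Polynomial R :=
  ((Polynomial.X : Polynomial R) • A.map Polynomial.C + A.transpose.map Polynomial.C).det

theorem natDegree_pencilPoly_le (A : Matrix (Fin N) (Fin N) R) :
    (pencilPoly A).natDegree ≤ N := by
  simpa [pencilPoly] using Polynomial.natDegree_det_X_add_C_le A A.transpose

theorem pencilPoly_coeff_top (A : Matrix (Fin N) (Fin N) R) :
    (pencilPoly A).coeff N = A.det := by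
  simpa [pencilPoly] using Polynomial.coeff_det_X_add_C_card A A.transpose

theorem map_pencilPoly {S : Type*} [CommRing S] (f : R →+* S) (A : Matrix (Fin N) (Fin N) R) :
    (pencilPoly A).map f = pencilPoly (A.map f) := by
  rw [pencilPoly, ← Polynomial.coe_mapRingHom, RingHom.map_det, pencilPoly]
  congr 1
  ext a b : 2
  simp

theorem coeff_pencilPoly_map {S : Type*} [CommRing S] (f : R →+* S)
    (A : Matrix (Fin N) (Fin N) R) (k : ℕ) :
    (pencilPoly (A.map f)).coeff k = f ((pencilPoly A).coeff k) := by
  rw [← map_pencilPoly, Polynomial.coeff_map]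

/-- The Laurent polynomial `det (λ A + λ⁻¹ Aᵀ)`. -/
def pencilLaurent (A : Matrix (Fin N) (Fin N) R) : LaurentPolynomial R :=
  (Matrix.of fun a b => LaurentPolynomial.T 1 * LaurentPolynomial.C (A a b) +
      LaurentPolynomial.T (-1) * LaurentPolynomial.C (A b a)).det

/-- Replacing `λ` by `λ⁻¹` transposes the matrix. -/
theorem invert_pencilLaurent (A : Matrix (Fin N) (Fin N) R) :
    LaurentPolynomial.invert (pencilLaurent A) = pencilLaurent A := by
  rw [pencilLaurent, AlgEquiv.map_det, ← Matrix.det_transpose]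
  congr 1
  ext a b : 2
  simp [add_comm]

/-- Pull `λ⁻¹` out of every row: the determinant is `λ^(-N)` times the polynomial pencil at `λ²`. -/
theorem pencilLaurent_eq_sum (A : Matrix (Fin N) (Fin N) R) :
    pencilLaurent A = ∑ k ∈ Finset.range (N + 1),
      LaurentPolynomial.C ((pencilPoly A).coeff k) * LaurentPolynomial.T (2 * (k : ℤ) - N) := by
  have h1 : pencilLaurent A = LaurentPolynomial.T (-(N : ℤ)) *
      (pencilPoly A).eval₂ LaurentPolynomial.C (LaurentPolynomial.T 2) := by
    rw [pencilPoly, ← Polynomial.coe_eval₂RingHom, RingHom.map_det]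
    have h2 : LaurentPolynomial.T (-(N : ℤ)) =
        (LaurentPolynomial.T (-1) : LaurentPolynomial R) ^ Fintype.card (Fin N) := by
      rw [LaurentPolynomial.T_pow, Fintype.card_fin, mul_neg_one]
    rw [h2, ← Matrix.det_smul, pencilLaurent]
    congr 1
    ext a b : 2
    simp only [Matrix.of_apply, Matrix.smul_apply, RingHom.mapMatrix_apply, Matrix.map_apply,
      Matrix.add_apply, smul_eq_mul, Polynomial.coe_eval₂RingHom, Polynomial.eval₂_add,
      Polynomial.eval₂_mul, Polynomial.eval₂_X, Polynomial.eval₂_C, Matrix.transpose_apply, mul_add]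
    rw [← mul_assoc, ← LaurentPolynomial.T_add]
    norm_num
  rw [h1, Polynomial.eval₂_eq_sum_range' _ (Nat.lt_succ_of_le (natDegree_pencilPoly_le A)),
    Finset.mul_sum]
  refine Finset.sum_congr rfl fun k _ => ?_
  rw [LaurentPolynomial.T_pow, LaurentPolynomial.T_mul, mul_assoc, ← LaurentPolynomial.T_add]
  congr 2
  ring

theorem coeff_pencilLaurent (A : Matrix (Fin N) (Fin N) R) (k : ℕ) (hk : k ≤ N) :
    (pencilLaurent A).coeff (2 * (k : ℤ) - N) = (pencilPoly A).coeff k := by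
  rw [pencilLaurent_eq_sum, AddMonoidAlgebra.coeff_sum, Finsupp.finsetSum_apply,
    Finset.sum_eq_single k]
  · rw [← LaurentPolynomial.single_eq_C_mul_T, AddMonoidAlgebra.coeff_single,
      Finsupp.single_eq_same]
  · intro b _ hb
    rw [← LaurentPolynomial.single_eq_C_mul_T]
    simp only [AddMonoidAlgebra.coeff_single]
    rw [Finsupp.single_apply, if_neg]
    omega
  · intro h
    exact absurd (Finset.mem_range.2 (by omega)) h

theorem coeff_pencilPoly_symm (A : Matrix (Fin N) (Fin N) R) (k : ℕ) (hk : k ≤ N) :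
    (pencilPoly A).coeff (N - k) = (pencilPoly A).coeff k := by
  rw [← coeff_pencilLaurent A k hk, ← coeff_pencilLaurent A (N - k) (Nat.sub_le _ _),
    ← invert_pencilLaurent, LaurentPolynomial.invert_apply, invert_pencilLaurent]
  congr 1
  push_cast [Nat.cast_sub hk]
  ring

end Pencil

theorem sum_range_pairs {M : Type*} [AddCommMonoid M] (N : ℕ) (f : ℕ → M) :
    ∑ k ∈ Finset.range (N + 1), f k =
      ∑ p ∈ Finset.range (N / 2 + 1), if 2 * p = N then f p else f p + f (N - p) := by
  induction N using Nat.twoStepInduction generalizing f with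
  | zero => simp
  | one => simp [Finset.sum_range_succ]
  | more N ih _ =>
    rw [Finset.sum_range_succ, Finset.sum_range_succ', ih (fun k => f (k + 1)),
      show (N + 2) / 2 = N / 2 + 1 by omega, Finset.sum_range_succ' _ (N / 2 + 1), add_assoc]
    congr 1
    · refine Finset.sum_congr rfl fun p hp => ?_
      rw [Finset.mem_range] at hp
      rw [show N + 2 - (p + 1) = N - p + 1 by omega]
      exact if_congr (by omega) rfl rfl

/-- The normalized coefficients of `det (X A + Aᵀ) / det A`. -/
def pencilCoeff {N : ℕ} {K : Type*} [Field K] (A : Matrix (Fin N) (Fin N) K) (k : ℕ) : K :=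
  (pencilPoly A).coeff k / A.det

/-- The invariants `Y_{p+1}` of a matrix under congruence. -/
def congruenceInvariant {N : ℕ} {K : Type*} [Field K] (A : Matrix (Fin N) (Fin N) K)
    (p : Fin (N / 2)) : K :=
  if 2 * (p.val + 1) = N then pencilCoeff A (p.val + 1) / 2 else pencilCoeff A (p.val + 1)

theorem pencil_coeff (N j k : ℕ) (hk : k ≤ N) :
    (pencil N j).coeff ((N : ℤ) - 2 * k) = pencilCoeff (mat N j 0) k := by
  rw [pencilCoeff, ← coeff_pencilPoly_symm _ k hk, ← coeff_pencilLaurent _ _ (Nat.sub_le N k),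
    pencil, ← pencilLaurent, ← LaurentPolynomial.smul_eq_C_mul, div_eq_inv_mul]
  push_cast [Nat.cast_sub hk]
  rw [show (2 : ℤ) * (N - k) - N = N - 2 * k by ring]
  rfl

theorem casimirY_eq (N j : ℕ) (p : Fin (N / 2)) :
    casimirY N j p = congruenceInvariant (mat N j 0) p := by
  have hp : p.val + 1 ≤ N := by omega
  rw [casimirY, congruenceInvariant, ← pencil_coeff N j _ hp]
  split_ifs with h
  · congr 2
    push_cast
    omega
  · push_cast
    rfl

theorem pencil_eq (N j : ℕ) (hN : 1 ≤ N) : pencil N j =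
    LaurentPolynomial.T (N : ℤ) + LaurentPolynomial.T (-(N : ℤ)) +
      ∑ p : Fin (N / 2),
        (LaurentPolynomial.T ((N : ℤ) - 2 * (p.val + 1)) +
          LaurentPolynomial.T (2 * (p.val + 1) - (N : ℤ))) *
        LaurentPolynomial.C (casimirY N j p) := by
  have hA := mat_det_ne_zero N j 0
  have h1 : pencil N j = ∑ k ∈ Finset.range (N + 1),
      LaurentPolynomial.C (pencilCoeff (mat N j 0) k) *
        LaurentPolynomial.T (2 * (k : ℤ) - N) := by
    rw [pencil, ← pencilLaurent, pencilLaurent_eq_sum, Finset.mul_sum]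
    refine Finset.sum_congr rfl fun k _ => ?_
    rw [← mul_assoc, ← map_mul, pencilCoeff, div_eq_inv_mul]
  have htop : pencilCoeff (mat N j 0) N = 1 := by
    rw [pencilCoeff, pencilPoly_coeff_top, div_self hA]
  have hsymm : ∀ k ≤ N, pencilCoeff (mat N j 0) (N - k) = pencilCoeff (mat N j 0) k :=
    fun k hk => by rw [pencilCoeff, coeff_pencilPoly_symm _ _ hk, pencilCoeff]
  have h0 : pencilCoeff (mat N j 0) 0 = 1 := by
    rw [← hsymm 0 (Nat.zero_le N), Nat.sub_zero, htop]
  rw [h1, sum_range_pairs, Finset.sum_range_succ', if_neg (by omega), Nat.sub_zero, h0, htop,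
    add_comm]
  congr 1
  · simp only [map_one, one_mul, Nat.cast_zero, mul_zero, zero_sub]
    rw [add_comm, show 2 * (N : ℤ) - N = N by ring]
  · rw [Finset.sum_range]
    refine Finset.sum_congr rfl fun p _ => ?_
    have hp : p.val + 1 ≤ N := by omega
    rw [casimirY_eq, congruenceInvariant]
    split_ifs with h
    · have e1 : 2 * ((p.val + 1 : ℕ) : ℤ) - N = 0 := by
        push_cast
        omega
      have e2 : (N : ℤ) - 2 * (p.val + 1) = 0 := by omega
      have e3 : 2 * ((p.val : ℤ) + 1) - N = 0 := by omega
      -- In the middle degree the two powers of `λ` coincide, and their sum `2` undoes the halving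
      -- in `congruenceInvariant`.
      rw [e1, e2, e3, LaurentPolynomial.T_zero, mul_one, one_add_one_eq_two,
        ← map_ofNat LaurentPolynomial.C 2, ← map_mul]
      congr 1
      field_simp
    · rw [hsymm _ hp, ← mul_add, mul_comm]
      congr 1
      push_cast [Nat.cast_sub hp]
      rw [add_comm]
      congr 2
      ring

/-! ### Invariance of the `Y_p` under infinitesimal congruence. -/

section Invariance

variable {F R : Type*} [CommRing F] [CommRing R] [Algebra F R]

/-- A derivation acting on the coefficients of polynomials. -/
def coeffDerivation (δ : Derivation F R R) :
    Derivation F (Polynomial R) (Polynomial R) :=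
  (PolynomialModule.equivPolynomialSelf (R := R)).toLinearMap.compDer δ.mapCoeffs

theorem coeff_coeffDerivation (δ : Derivation F R R) (P : Polynomial R) (k : ℕ) :
    (coeffDerivation δ P).coeff k = δ (P.coeff k) := rfl

/-- Extend `δ` to polynomials with `X` constant. Then `X A + Aᵀ` undergoes the same congruence as
`A`, so its determinant scales by `2 tr G`, which is free of `X` and hence acts coefficientwise. -/
theorem derivation_coeff_pencilPoly {N : ℕ} (δ : Derivation F R R)
    {A G : Matrix (Fin N) (Fin N) R} (h : A.map δ = G * A + A * G.transpose) (k : ℕ) :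
    δ ((pencilPoly A).coeff k) = 2 * G.trace * (pencilPoly A).coeff k := by
  have hC : ∀ M : Matrix (Fin N) (Fin N) R,
      (M.map Polynomial.C).map (coeffDerivation δ) = (M.map δ).map Polynomial.C := by
    intro M
    ext a b n
    simp only [Matrix.map_apply, coeff_coeffDerivation, Polynomial.coeff_C]
    split_ifs <;> simp
  have hX : coeffDerivation δ Polynomial.X = 0 := by
    ext n
    simp only [coeff_coeffDerivation, Polynomial.coeff_X]
    split_ifs <;> simp
  have hs : ∀ M : Matrix (Fin N) (Fin N) (Polynomial R),
      ((Polynomial.X : Polynomial R) • M).map (coeffDerivation δ) =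
        (Polynomial.X : Polynomial R) • M.map (coeffDerivation δ) := by
    intro M
    ext1 a b
    simp [hX]
  have ht : A.transpose.map δ = G * A.transpose + A.transpose * G.transpose := by
    rw [Matrix.transpose_map, h]
    simp [add_comm]
  have hm : ∀ M M' : Matrix (Fin N) (Fin N) R,
      (M * M').map Polynomial.C = M.map Polynomial.C * M'.map Polynomial.C :=
    fun M M' => Matrix.map_mul
  have ha : ∀ M M' : Matrix (Fin N) (Fin N) R,
      (M + M').map Polynomial.C = M.map Polynomial.C + M'.map Polynomial.C :=
    fun M M' => Matrix.map_add _ (map_add _) M M'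
  have key : ((Polynomial.X : Polynomial R) • A.map Polynomial.C +
      A.transpose.map Polynomial.C).map (coeffDerivation δ) =
      G.map Polynomial.C * ((Polynomial.X : Polynomial R) • A.map Polynomial.C +
        A.transpose.map Polynomial.C) + ((Polynomial.X : Polynomial R) • A.map Polynomial.C +
        A.transpose.map Polynomial.C) * G.transpose.map Polynomial.C := by
    rw [Matrix.map_add _ (map_add _), hs, hC, hC, h, ht, ha, ha, hm, hm, hm, hm]
    simp only [Matrix.mul_add, Matrix.add_mul, Matrix.mul_smul, Matrix.smul_mul, smul_add]
    abel
  have h1 := congrArg (fun P => Polynomial.coeff P k) (derivation_det_of_map_eq _ key)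
  have h2 : (G.map Polynomial.C).trace + (G.transpose.map Polynomial.C).trace =
      Polynomial.C (2 * G.trace) := by
    rw [Matrix.transpose_map, Matrix.trace_transpose]
    simp [Matrix.trace, two_mul]
  rw [h2] at h1
  simp only [coeff_coeffDerivation, Polynomial.coeff_C_mul] at h1
  exact h1

theorem derivation_congruenceInvariant {F K : Type*} [Field F] [Field K] [Algebra F K] {N : ℕ}
    (δ : Derivation F K K) {A G : Matrix (Fin N) (Fin N) K}
    (h : A.map δ = G * A + A * G.transpose) (p : Fin (N / 2)) :
    δ (congruenceInvariant A p) = 0 := by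
  have h1 : ∀ k, δ (pencilCoeff A k) = 0 := by
    intro k
    have hd : IsEigen δ A.det (2 * G.trace) := by
      rw [← pencilPoly_coeff_top]
      exact derivation_coeff_pencilPoly δ h N
    have hk : IsEigen δ ((pencilPoly A).coeff k) (2 * G.trace) :=
      derivation_coeff_pencilPoly δ h k
    have := hk.div hd
    rw [sub_self, IsEigen, zero_mul] at this
    exact this
  rw [congruenceInvariant]
  split_ifs
  · have h2 : IsEigen δ (2 : K) 0 := by
      rw [IsEigen, zero_mul]
      exact_mod_cast δ.map_natCast 2
    have h3 : IsEigen δ (pencilCoeff A (p.val + 1)) 0 := by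
      rw [IsEigen, zero_mul]
      exact h1 _
    simpa [IsEigen] using h3.div h2
  · exact h1 _

theorem ChainFlow.derivation_casimirY {N j : ℕ} {δ : Derivation ℂ (RatFun N j) (RatFun N j)}
    {L : Matrix (Fin N) (Fin N) (RatFun N j)} {G H Q : ℕ → Matrix (Fin N) (Fin N) (RatFun N j)}
    (h : ChainFlow N j δ L G H Q) (p : Fin (N / 2)) : δ (casimirY N j p) = 0 := by
  rw [casimirY_eq]
  exact derivation_congruenceInvariant δ h.map_zero p

theorem isCasimir_casimirY (N j : ℕ) (p : Fin (N / 2)) : IsCasimir N j (casimirY N j p) := by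
  refine isCasimir_of_bracketDerivation fun v => ?_
  obtain ⟨l, c, d⟩ := v
  refine Fin.cases ?_ (fun l => ?_) l
  · exact (chainFlow_zero N j c d).derivation_casimirY p
  · exact (chainFlow_succ N j l c d).derivation_casimirY p

end Invariance

/-! ### Algebraic independence of the `Y_p`. -/

/-- Algebraic independence of fractions with a common denominator can be checked after a
specialization at which the denominator does not vanish. -/
theorem algebraicIndependent_div_of_specialization {F R K L ι : Type*} [Field F] [CommRing R]
    [Field K] [Field L] [Algebra F R] [Algebra F K] [Algebra F L] [Algebra R K]
    [IsScalarTower F R K] [IsFractionRing R K] (φ : R →ₐ[F] L) (d : R) (hd : φ d ≠ 0)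
    (f : ι → R) (h : AlgebraicIndependent F fun i => φ (f i) / φ d) :
    AlgebraicIndependent F fun i => algebraMap R K (f i) / algebraMap R K d := by
  have hdK : algebraMap R K d ≠ 0 := by
    intro h0
    rw [map_eq_zero_iff _ (IsFractionRing.injective R K)] at h0
    exact hd (by rw [h0, map_zero])
  have hK : ∀ y : Submonoid.powers d, IsUnit (algebraMap R K y) := by
    rintro ⟨_, n, rfl⟩
    simpa using hdK.isUnit.pow n
  have hL : ∀ y : Submonoid.powers d, IsUnit (φ.toRingHom y) := by
    rintro ⟨_, n, rfl⟩
    simpa using hd.isUnit.pow n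
  let gK : Localization (Submonoid.powers d) →+* K := IsLocalization.lift hK
  let gL : Localization (Submonoid.powers d) →+* L := IsLocalization.lift hL
  let z : ι → Localization (Submonoid.powers d) :=
    fun i => IsLocalization.mk' _ (f i) (⟨d, Submonoid.mem_powers d⟩ : Submonoid.powers d)
  have hgK : ∀ r : R, gK (algebraMap R _ r) = algebraMap R K r := fun r =>
    IsLocalization.lift_eq hK r
  have hgL : ∀ r : R, gL (algebraMap R _ r) = φ r := fun r => IsLocalization.lift_eq hL r
  have hspec : ∀ i, z i * algebraMap R (Localization (Submonoid.powers d)) d =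
      algebraMap R _ (f i) := fun i => IsLocalization.mk'_spec _ _ _
  have hzK : ∀ i, gK (z i) = algebraMap R K (f i) / algebraMap R K d := by
    intro i
    rw [eq_div_iff hdK, ← hgK, ← hgK, ← map_mul, hspec]
  have hzL : ∀ i, gL (z i) = φ (f i) / φ d := by
    intro i
    rw [eq_div_iff hd, ← hgL, ← hgL, ← map_mul, hspec]
  -- The localization at powers of `d` embeds in `K` and also maps to `L`; independence lifts from
  -- `L` to it and is carried injectively into `K`.
  have hinj : Function.Injective gK := by
    rw [IsLocalization.lift_injective_iff]
    intro x y
    constructor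
    · intro hxy
      have := congrArg gK hxy
      rw [hgK, hgK] at this
      exact this
    · intro hxy
      rw [IsFractionRing.injective R K hxy]
  let aK : Localization (Submonoid.powers d) →ₐ[F] K :=
    { gK with
      commutes' := fun c => by
        change gK (algebraMap F _ c) = _
        rw [IsScalarTower.algebraMap_apply F R, hgK, ← IsScalarTower.algebraMap_apply] }
  let aL : Localization (Submonoid.powers d) →ₐ[F] L :=
    { gL with
      commutes' := fun c => by
        change gL (algebraMap F _ c) = _
        rw [IsScalarTower.algebraMap_apply F R, hgL, AlgHom.commutes] }
  have h1 : AlgebraicIndependent F z :=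
    AlgebraicIndependent.of_comp aL (by
      convert h using 1
      funext i
      exact hzL i)
  have h2 := h1.map' (f := aK) hinj
  convert h2 using 1
  funext i
  exact (hzK i).symm

/-- Finitely many elements over which the generators of a function field are algebraic are
algebraically independent if there are no more of them than generators. -/
theorem algebraicIndependent_of_isAlgebraic_X {F : Type*} [Field F] {m : ℕ}
    (y : Fin m → FractionRing (MvPolynomial (Fin m) F))
    (h : ∀ i, IsAlgebraic (Algebra.adjoin F (Set.range y))
      (algebraMap (MvPolynomial (Fin m) F) (FractionRing (MvPolynomial (Fin m) F))
        (MvPolynomial.X i))) : AlgebraicIndependent F y := by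
  set S := Algebra.adjoin F (Set.range y)
  have hpoly : ∀ P : MvPolynomial (Fin m) F,
      IsAlgebraic S (algebraMap _ (FractionRing (MvPolynomial (Fin m) F)) P) := by
    intro P
    induction P using MvPolynomial.induction_on with
    | C a =>
      have : algebraMap (MvPolynomial (Fin m) F) (FractionRing (MvPolynomial (Fin m) F))
          (MvPolynomial.C a) = algebraMap S _ (algebraMap F S a) := by
        rw [← IsScalarTower.algebraMap_apply, ← MvPolynomial.algebraMap_eq,
          ← IsScalarTower.algebraMap_apply]
      rw [this]
      exact isAlgebraic_algebraMap _
    | add p q hp hq =>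
      rw [map_add]
      exact hp.add hq
    | mul_X p i hp =>
      rw [map_mul]
      exact hp.mul (h i)
  have halg : Algebra.IsAlgebraic S (FractionRing (MvPolynomial (Fin m) F)) := by
    refine ⟨fun z => ?_⟩
    obtain ⟨a, b, _, rfl⟩ := IsFractionRing.div_surjective (A := MvPolynomial (Fin m) F) z
    rw [div_eq_mul_inv]
    exact (hpoly a).mul (hpoly b).inv
  have hx : AlgebraicIndependent F fun i : Fin m =>
      algebraMap (MvPolynomial (Fin m) F) (FractionRing (MvPolynomial (Fin m) F))
        (MvPolynomial.X i) :=
    (MvPolynomial.algebraicIndependent_X (Fin m) F).map'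
      (f := IsScalarTower.toAlgHom F _ (FractionRing (MvPolynomial (Fin m) F)))
      (IsFractionRing.injective _ _)
  -- The variables show that the transcendence degree is at least `m`, so `m` elements over which
  -- the field is algebraic form a transcendence basis.
  exact (Algebra.IsAlgebraic.isTranscendenceBasis_of_lift_le_trdeg_of_finite F y
    hx.lift_cardinalMk_le_trdeg).1

section Antidiagonal

variable {N : ℕ} {K : Type*} [Field K]

/-- The matrix with entries `a_i` on the antidiagonal. -/
def antidiagonal (a : Fin N → K) : Matrix (Fin N) (Fin N) K :=
  Matrix.of fun i k => if k = i.rev then a i else 0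

theorem antidiagonal_det_ne_zero {a : Fin N → K} (ha : ∀ i, a i ≠ 0) :
    (antidiagonal a).det ≠ 0 := by
  have h : (antidiagonal a).submatrix id Fin.revPerm = Matrix.diagonal a := by
    ext i k
    simp [antidiagonal, Matrix.diagonal_apply, eq_comm]
  have h1 := Matrix.det_permute' Fin.revPerm (antidiagonal a)
  rw [h, Matrix.det_diagonal] at h1
  intro h0
  rw [h0, mul_zero] at h1
  exact Finset.prod_ne_zero_iff.2 (fun i _ => ha i) h1

/-- Row `i` of `μ A + Aᵀ` has `μ a_i + a_{rev i}` as its only possibly nonzero entry. -/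
theorem eval_pencilPoly_antidiagonal {a : Fin N → K} {i : Fin N} {μ : K}
    (h : μ * a i + a i.rev = 0) : (pencilPoly (antidiagonal a)).eval μ = 0 := by
  rw [pencilPoly, ← Polynomial.coe_evalRingHom, RingHom.map_det]
  refine Matrix.det_eq_zero_of_row_eq_zero i fun k => ?_
  by_cases hk : k = i.rev
  · subst hk
    rw [mul_comm] at h
    simpa [antidiagonal] using h
  · have : i ≠ k.rev := fun h => hk (by rw [h, Fin.rev_rev])
    simp [antidiagonal, hk, this]

end Antidiagonal

theorem congruenceInvariant_algebraicIndependent (N : ℕ) :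
    ∃ A : Matrix (Fin N) (Fin N) (FractionRing (MvPolynomial (Fin (N / 2)) ℂ)),
      A.det ≠ 0 ∧ AlgebraicIndependent ℂ (congruenceInvariant A) := by
  set L := FractionRing (MvPolynomial (Fin (N / 2)) ℂ)
  let x : Fin (N / 2) → L := fun i => algebraMap (MvPolynomial (Fin (N / 2)) ℂ) L
    (MvPolynomial.X i)
  have hx : ∀ i, x i ≠ 0 := fun i h => by
    rw [map_eq_zero_iff _ (IsFractionRing.injective _ _)] at h
    exact MvPolynomial.X_ne_zero i h
  -- Each variable is paired with a `1` at the mirrored position, so `-1/x_i` is a root of the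
  -- pencil.
  let a : Fin N → L := fun i => if h : i.val < N / 2 then x ⟨i.val, h⟩ else 1
  have ha : ∀ i, a i ≠ 0 := by
    intro i
    simp only [a]
    split_ifs
    · exact hx _
    · exact one_ne_zero
  have hdet := antidiagonal_det_ne_zero ha
  refine ⟨antidiagonal a, hdet, algebraicIndependent_of_isAlgebraic_X _ fun i => ?_⟩
  set A := antidiagonal a
  set S := Algebra.adjoin ℂ (Set.range (congruenceInvariant A))
  have htop : pencilCoeff A N = 1 := by
    rw [pencilCoeff, pencilPoly_coeff_top, div_self hdet]
  have hsymm : ∀ k ≤ N, pencilCoeff A (N - k) = pencilCoeff A k :=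
    fun k hk => by rw [pencilCoeff, coeff_pencilPoly_symm _ _ hk, pencilCoeff]
  have hlow : ∀ k, k ≤ N / 2 → pencilCoeff A k ∈ S := by
    intro k hk
    rcases Nat.eq_zero_or_pos k with rfl | hpos
    · rw [← hsymm 0 (Nat.zero_le N), Nat.sub_zero, htop]
      exact S.one_mem
    · have hmem : congruenceInvariant A ⟨k - 1, by omega⟩ ∈ S :=
        Algebra.subset_adjoin ⟨_, rfl⟩
      rw [congruenceInvariant] at hmem
      simp only [Nat.sub_add_cancel hpos] at hmem
      split_ifs at hmem
      · have := S.add_mem hmem hmem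
        rwa [add_halves] at this
      · exact hmem
  have hcoeff : ∀ k, pencilCoeff A k ∈ S := by
    intro k
    rcases le_or_gt k (N / 2) with hk | hk
    · exact hlow k hk
    · rcases le_or_gt k N with hkN | hkN
      · rw [← hsymm k hkN]
        exact hlow _ (by omega)
      · rw [pencilCoeff, Polynomial.coeff_eq_zero_of_natDegree_lt
          ((natDegree_pencilPoly_le A).trans_lt hkN), zero_div]
        exact S.zero_mem
  have hmem : ∀ n, (Polynomial.C (A.det)⁻¹ * pencilPoly A).coeff n ∈ S := by
    intro n
    rw [Polynomial.coeff_C_mul, ← div_eq_inv_mul]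
    exact hcoeff n
  obtain ⟨P, hP⟩ : ∃ P : Polynomial S,
      P.map (algebraMap S L) = Polynomial.C (A.det)⁻¹ * pencilPoly A := by
    refine (Polynomial.mem_lifts _).1 ((Polynomial.lifts_iff_coeff_lifts _).2 fun n => ?_)
    exact ⟨⟨_, hmem n⟩, rfl⟩
  -- The pencil divided by `det A` is monic of degree `N` with coefficients in `S`: the lower half
  -- are the invariants (the middle one up to a factor `2`), the upper half follow by symmetry.
  have hroot : IsAlgebraic S (-(x i)⁻¹) := by
    refine ⟨P, ?_, ?_⟩
    · rintro rfl
      have h1 := congrArg (fun q => Polynomial.coeff q N) hP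
      simp only [Polynomial.map_zero, Polynomial.coeff_zero, Polynomial.coeff_C_mul,
        pencilPoly_coeff_top] at h1
      exact mul_ne_zero (inv_ne_zero hdet) hdet h1.symm
    · rw [Polynomial.aeval_def, ← Polynomial.eval_map, hP, Polynomial.eval_mul,
        eval_pencilPoly_antidiagonal (i := ⟨i.val, by omega⟩), mul_zero]
      have h1 : a ⟨i.val, by omega⟩ = x i := by simp [a]
      have h2 : a (Fin.rev ⟨i.val, by omega⟩) = 1 := by
        simp only [a, Fin.val_rev]
        rw [dif_neg]
        omega
      rw [h1, h2, neg_mul, inv_mul_cancel₀ (hx i), neg_add_cancel]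
  have h1 : IsAlgebraic S (x i)⁻¹ := by
    have h2 := hroot.neg
    rwa [neg_neg (x i)⁻¹] at h2
  exact IsAlgebraic.inv_iff.1 h1

theorem algebraicIndependent_casimirY (N j : ℕ) :
    AlgebraicIndependent ℂ (casimirY N j) := by
  obtain ⟨A, hdet, hA⟩ := congruenceInvariant_algebraicIndependent N
  let φ : MvPolynomial (Idx N j) ℂ →ₐ[ℂ] FractionRing (MvPolynomial (Fin (N / 2)) ℂ) :=
    MvPolynomial.aeval fun u => A u.2.1 u.2.2
  have hφ : (polyMat N j 0).map φ.toRingHom = A := by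
    ext a b
    simp [polyMat, φ]
  have hφd : φ (polyMat N j 0).det = A.det := by
    rw [← hφ]
    exact AlgHom.map_det φ _
  have hφc : ∀ k, φ ((pencilPoly (polyMat N j 0)).coeff k) = (pencilPoly A).coeff k := by
    intro k
    rw [← hφ]
    exact (coeff_pencilPoly_map φ.toRingHom _ k).symm
  let f : Fin (N / 2) → MvPolynomial (Idx N j) ℂ := fun p =>
    if 2 * (p.val + 1) = N then
      MvPolynomial.C (1 / 2) * (pencilPoly (polyMat N j 0)).coeff (p.val + 1)
    else (pencilPoly (polyMat N j 0)).coeff (p.val + 1)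
  have key := algebraicIndependent_div_of_specialization (K := RatFun N j) φ
    (polyMat N j 0).det (by rwa [hφd]) f ?_
  · have h1 : casimirY N j = fun p => algebraMap _ (RatFun N j) (f p) /
        algebraMap _ (RatFun N j) (polyMat N j 0).det := by
      funext p
      rw [casimirY_eq, congruenceInvariant, pencilCoeff, mat_det_eq, ← map_polyMat,
        coeff_pencilPoly_map]
      simp only [f]
      split_ifs
      · rw [map_mul, ← MvPolynomial.algebraMap_eq, ← IsScalarTower.algebraMap_apply]
        simp only [one_div, map_inv₀, map_ofNat]
        ring
      · rfl
    rw [h1]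
    exact key
  · have h1 : (fun p => φ (f p) / φ (polyMat N j 0).det) = congruenceInvariant A := by
      funext p
      rw [congruenceInvariant, pencilCoeff, hφd]
      simp only [f]
      split_ifs
      · rw [map_mul, hφc, ← MvPolynomial.algebraMap_eq, AlgHom.commutes]
        simp only [one_div, map_inv₀, map_ofNat]
        ring
      · rw [hφc]
    rw [h1]
    exact hA

/-! ### Independence of eigenvectors over constants. -/

section Weights

variable {F K κ : Type*} [Field F] [Field K] [Algebra F K] (δ : κ → Derivation F K K)

/-- Simultaneous eigenvectors of a family of derivations with distinct constant eigenvalues are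
linearly independent. -/
theorem eq_zero_of_sum_eigen_eq_zero {M : Type*} (s : Finset M) (w : κ → M → F)
    (hw : ∀ m ∈ s, ∀ m' ∈ s, (∀ i, w i m = w i m') → m = m') (f : M → K)
    (hf : ∀ i, ∀ m ∈ s, IsEigen (δ i) (f m) (algebraMap F K (w i m)))
    (h0 : ∑ m ∈ s, f m = 0) : ∀ m ∈ s, f m = 0 := by
  classical
  induction s using Finset.induction_on generalizing f with
  | empty => simp
  | insert a s ha ih =>
    have hs : ∀ m ∈ s, f m = 0 := by
      intro m hm
      obtain ⟨i, hi⟩ : ∃ i, w i m ≠ w i a := by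
        by_contra! hcon
        have := hw m (Finset.mem_insert_of_mem hm) a (Finset.mem_insert_self a s) hcon
        exact ha (this ▸ hm)
      -- Applying `δ i - w i a` to the relation removes the term of `a` and rescales the others; the
      -- term of `m` keeps a nonzero factor.
      have h1 := ih (fun m hm m' hm' => hw m (Finset.mem_insert_of_mem hm) m'
        (Finset.mem_insert_of_mem hm')) (fun m => algebraMap F K (w i m - w i a) * f m)
        (fun i' m hm => by
          have h2 := hf i' m (Finset.mem_insert_of_mem hm)
          rw [IsEigen] at h2 ⊢
          rw [Derivation.leibniz, Derivation.map_algebraMap, h2]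
          simp only [smul_eq_mul]
          ring) ?_ m hm
      · rcases mul_eq_zero.1 h1 with h | h
        · rw [map_eq_zero_iff _ (algebraMap F K).injective, sub_eq_zero] at h
          exact absurd h hi
        · exact h
      · have h2 := congrArg (δ i) h0
        rw [map_zero, map_sum, Finset.sum_congr rfl fun m hm => hf i m hm,
          Finset.sum_insert ha] at h2
        rw [Finset.sum_insert ha] at h0
        have h3 : ∑ m ∈ s, algebraMap F K (w i m - w i a) * f m =
            (∑ m ∈ s, algebraMap F K (w i m) * f m) -
              algebraMap F K (w i a) * ∑ m ∈ s, f m := by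
          rw [Finset.mul_sum, ← Finset.sum_sub_distrib]
          refine Finset.sum_congr rfl fun m _ => ?_
          rw [map_sub, sub_mul]
        rw [h3]
        linear_combination h2 - algebraMap F K (w i a) * h0
    intro m hm
    rcases Finset.mem_insert.1 hm with rfl | hm
    · rwa [Finset.sum_insert ha, Finset.sum_eq_zero hs, add_zero] at h0
    · exact hs m hm

/-- Eigenvectors with independent eigenvalues are algebraically independent over constants. -/
theorem algebraicIndependent_sumElim_of_eigen [CharZero F] [Fintype κ] [DecidableEq κ] {ι : Type*}
    {Y : ι → K} (hY : AlgebraicIndependent F Y) (hδY : ∀ i p, δ i (Y p) = 0)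
    {X : κ → K} (hX : ∀ p, X p ≠ 0) (W : Matrix κ κ F) (hW : W.det ≠ 0)
    (hδX : ∀ i p, IsEigen (δ i) (X p) (algebraMap F K (W i p))) :
    AlgebraicIndependent F (Sum.elim Y X) := by
  set S := Algebra.adjoin F (Set.range Y)
  have hS : ∀ i, ∀ s ∈ S, δ i s = 0 := by
    intro i s hs
    induction hs using Algebra.adjoin_induction with
    | mem x hx =>
      obtain ⟨p, rfl⟩ := hx
      exact hδY i p
    | algebraMap r => exact Derivation.map_algebraMap _ r
    | add x y _ _ hx hy => rw [map_add, hx, hy, add_zero]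
    | mul x y _ _ hx hy => rw [Derivation.leibniz, hx, hy, smul_zero, smul_zero, add_zero]
  have hind : AlgebraicIndependent S X := by
    rw [algebraicIndependent_iff]
    intro P hP
    rw [MvPolynomial.aeval_def, MvPolynomial.eval₂_eq'] at hP
    -- The term with exponent `m` has weight `W m`, since its coefficient lies in `S` and is killed
    -- by every `δ i`. As `W` is invertible in characteristic zero, distinct exponents have distinct
    -- weights.
    have key := eq_zero_of_sum_eigen_eq_zero δ P.support
      (fun i m => W.mulVec (fun p => (m p : F)) i) ?_ _ ?_ hP
    · ext m
      by_contra hm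
      have h1 := key m (MvPolynomial.mem_support_iff.2 fun h => hm (by rw [h]; simp))
      rcases mul_eq_zero.1 h1 with h | h
      · exact hm (by simpa using h)
      · exact Finset.prod_ne_zero_iff.2 (fun p _ => pow_ne_zero _ (hX p)) h
    · intro m _ m' _ h
      have h1 := Matrix.mulVec_injective_of_isUnit
        ((Matrix.isUnit_iff_isUnit_det W).2 hW.isUnit) (funext h)
      ext p
      exact_mod_cast congrFun h1 p
    · intro i m _
      have h1 : IsEigen (δ i) (algebraMap S K (P.coeff m)) 0 := by
        rw [IsEigen, zero_mul]
        exact hS i _ (P.coeff m).2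
      have h2 := h1.mul (IsEigen.prod (s := Finset.univ) fun p _ => (hδX i p).pow (m p))
      convert h2 using 1
      rw [zero_add, Matrix.mulVec, dotProduct, map_sum]
      refine Finset.sum_congr rfl fun p _ => ?_
      rw [map_mul, map_natCast, mul_comm]
  have h := hY.sumElim hind
  have h1 := h.comp Sum.swap Sum.swap_leftInverse.injective
  convert h1 using 1
  funext z
  rcases z with z | z <;> rfl

end Weights

/-! ### The torus action that separates the `X_p`. -/

section Torus

variable (N j : ℕ)

/-- The infinitesimal action `A ↦ E_{ii} A + A E_{ii}`, `B₁ ↦ B₁ E_{ii}`. -/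
def torusMat (i : Fin N) (k : Fin (j + 1)) : Matrix (Fin N) (Fin N) (RatFun N j) :=
  if k.val = 0 then Matrix.single i i 1 * mat N j k + mat N j k * Matrix.single i i 1
  else if k.val = 1 then mat N j k * Matrix.single i i 1 else 0

/-- The derivation generating the torus action `A ↦ T A T`, `B₁ ↦ B₁ T`, where `T` is the diagonal
matrix with a parameter at position `i`. -/
def torusDerivation (i : Fin N) : Derivation ℂ (RatFun N j) (RatFun N j) :=
  ∑ u : Idx N j, torusMat N j i u.1 u.2.1 u.2.2 • partialDeriv N j u

theorem map_torusDerivation_mat (i : Fin N) (k : Fin (j + 1)) :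
    (mat N j k).map (torusDerivation N j i) = torusMat N j i k := by
  ext a b
  rw [Matrix.map_apply, torusDerivation]
  simp only [← Derivation.coeFnAddMonoidHom_apply, map_sum, Finset.sum_apply]
  exact sum_smul_partialDeriv_coord (fun u => torusMat N j i u.1 u.2.1 u.2.2) (k, a, b)

theorem isLower_single (i : Fin N) {K : Type*} [Field K] :
    IsLower (Matrix.single i i (1 : K)) := by
  intro a b h
  rw [Matrix.single_apply, if_neg]
  rintro ⟨rfl, rfl⟩
  exact lt_irrefl _ h

/-- In `Aᵀ B₁⁻¹` the right factor `T` of `Aᵀ` cancels against that of `B₁`, so `S` becomes `T S`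
when `j ≥ 1`; for `j = 0` it becomes `T S T`. A diagonal `T` is lower triangular, so the weight
computations for minors apply. -/
theorem chainFlow_torus (i : Fin N) :
    ChainFlow N j (torusDerivation N j i) (Matrix.single i i 1)
      (fun k => if k = 0 then Matrix.single i i 1 else 0)
      (fun k => if k = 1 then Matrix.single i i 1 else 0)
      (fun k => if k = 0 then Matrix.single i i 1 else 0) where
  map_zero := by
    rw [map_torusDerivation_mat]
    simp [torusMat]
  map_succ k := by
    rw [map_torusDerivation_mat]
    by_cases hk : k.val = 0 <;> simp [torusMat, hk]
  map_transpose := by simp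
  compat k := by
    by_cases hk : k.val = 0 <;> simp [hk]
  lower_L := isLower_single N i
  lower_G k := by simpa using IsLower.zero
  lower_H k := by
    split_ifs
    · exact isLower_single N i
    · exact IsLower.zero
  lower_Q := by
    split_ifs
    · exact isLower_single N i
    · exact IsLower.zero

variable {N} {K : Type*} [Field K]

theorem single_diag (i a : Fin N) :
    Matrix.single i i (1 : K) a a = if a = i then 1 else 0 := by
  rw [Matrix.single_apply]
  exact if_congr (by rw [and_self, eq_comm]) rfl rfl

theorem headTrace_single (i : Fin N) (p : ℕ) (hp : p ≤ N) :
    headTrace (Matrix.single i i (1 : K)) p hp = cut 1 i p :=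
  headTrace_of_diag (single_diag i) p hp

theorem tailTrace_single (i : Fin N) (p : ℕ) (hp : p ≤ N) :
    tailTrace (Matrix.single i i (1 : K)) p hp = 1 - cut 1 i (N - p) :=
  tailTrace_eq_of_diag (single_diag i) p hp

theorem evenWeight_torus (i : Fin N) (p : ℕ) (hp : p ≤ N) :
    ChainFlow.evenWeight (j := j) (Matrix.single i i 1)
      (fun k => if k = 0 then Matrix.single i i 1 else 0)
      (fun k => if k = 1 then Matrix.single i i 1 else 0)
      (fun k => if k = 0 then Matrix.single i i 1 else 0) p hp =
      cut 1 i p + (1 - cut 1 i (N - p)) := by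
  rcases j with _ | j
  · simp [ChainFlow.evenWeight, headTrace_single, tailTrace_single]
  · simp [ChainFlow.evenWeight, headTrace_single, tailTrace_single, headTrace_zero,
      tailTrace_zero, Finset.sum_range_succ']

theorem oddWeight_torus (r : ℕ) (i : Fin N) (p : ℕ) (hp : p ≤ N) :
    oddWeight (r := r) (Matrix.single i i 1)
      (fun k => if k = 0 then Matrix.single i i 1 else 0)
      (fun k => if k = 1 then Matrix.single i i 1 else 0)
      (fun k => if k = 0 then Matrix.single i i 1 else 0) p hp =
      2 * (cut 1 i p + cut 1 i (N - p) - 1) := by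
  have hp' : N - (N - p) = p := by omega
  simp [oddWeight, ChainFlow.minorWeight, headTrace_single, tailTrace_single, headTrace_zero,
      tailTrace_zero, Finset.sum_range_succ', hp']
  ring

theorem isEigen_torus_casimirXEven (hj : Even j) (i p : Fin ((N + 1) / 2)) :
    IsEigen (torusDerivation N j (Fin.castLE (by omega) i)) (casimirXEven N j p)
      (algebraMap ℂ (RatFun N j) (if p ≤ i then -2 else 0)) := by
  have h := (chainFlow_torus N j (Fin.castLE (by omega) i)).isEigen_casimirXEven hj p
  rw [evenWeight_torus, evenWeight_torus] at h
  convert h using 1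
  have hp : N - (N - p.val) = p.val := by omega
  rw [hp]
  simp only [cut, Fin.val_castLE, Fin.le_def]
  -- Both indices are at most `[(N+1)/2] - 1`, so `i + p ≤ N - 1`; the cut at `N - p` is always `1`,
  -- which makes the weight matrix triangular.
  have h1 : i.val < N - p.val := by omega
  rw [if_pos h1]
  split_ifs <;> first
    | omega
    | simp
  rw [map_ofNat (algebraMap ℂ (RatFun N j)) 2]
  norm_num

theorem isEigen_torus_casimirXOdd (r : ℕ) (i p : Fin (N / 2)) :
    IsEigen (torusDerivation N (2 * r + 1) (Fin.castLE (by omega) i)) (casimirXOdd N r p)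
      (algebraMap ℂ (RatFun N (2 * r + 1)) (if i ≤ p then 2 else 0)) := by
  have h := (chainFlow_torus N (2 * r + 1) (Fin.castLE (by omega) i)).isEigen_casimirXOdd p
  rw [oddWeight_torus] at h
  convert h using 1
  simp only [cut, Fin.val_castLE, Fin.le_def]
  have h1 : i.val < N - (p.val + 1) := by omega
  rw [if_pos h1]
  split_ifs <;> first
    | omega
    | simp
  exact map_ofNat (algebraMap ℂ (RatFun N (2 * r + 1))) 2

end Torus

/-! ### Nonvanishing of the minors, by evaluation at points. -/

section Nonvanishing

/-- The point of the phase space with `A = M`, `B_k = 1`, as an evaluation. -/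
def evalAt (N j : ℕ) (M : Matrix (Fin N) (Fin N) ℂ) : MvPolynomial (Idx N j) ℂ →+* ℂ :=
  MvPolynomial.eval fun u => if u.1 = 0 then M u.2.1 u.2.2 else (1 : Matrix _ _ ℂ) u.2.1 u.2.2

theorem minor_mat_ne_zero (N j : ℕ) (k : Fin (j + 1)) {p : ℕ} (f g : Fin p → Fin N)
    (M : Matrix (Fin N) (Fin N) ℂ) (hM : (M.submatrix f g).det ≠ 0) :
    ((mat N j k).submatrix f g).det ≠ 0 := by
  have h1 : ((mat N j k).submatrix f g).det =
      algebraMap _ (RatFun N j) ((polyMat N j k).submatrix f g).det := by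
    rw [RingHom.map_det]
    rfl
  rw [h1, Ne, map_eq_zero_iff _ (algebraMap_ratFun_injective N j)]
  intro h
  have h2 := congrArg (MvPolynomial.eval fun u : Idx N j => M u.2.1 u.2.2) h
  rw [RingHom.map_det, map_zero] at h2
  apply hM
  rw [← h2]
  congr 1
  ext a b
  simp [polyMat]

/-- Evaluation is defined only on polynomials, so the inverses in `S` are written as a nonzero
scalar times an adjugate. At `B_k = 1` the polynomial part is the identity, which reduces minors of
`S` to those of `Aᵀ`. -/
theorem exists_smul_map_of_prod (N j : ℕ) (M : Matrix (Fin N) (Fin N) ℂ) :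
    ∃ d : RatFun N j, d ≠ 0 ∧ ∃ P : Matrix (Fin N) (Fin N) (MvPolynomial (Idx N j) ℂ),
      (List.ofFn fun k : Fin j =>
        if Even k.val then (mat N j k.succ)⁻¹ else (mat N j k.succ).transpose).prod =
        d • P.map (algebraMap _ (RatFun N j)) ∧ P.map (evalAt N j M) = 1 := by
  refine List.prod_induction (fun X : Matrix (Fin N) (Fin N) (RatFun N j) =>
    ∃ d : RatFun N j, d ≠ 0 ∧ ∃ P : Matrix (Fin N) (Fin N) (MvPolynomial (Idx N j) ℂ),
      X = d • P.map (algebraMap _ (RatFun N j)) ∧ P.map (evalAt N j M) = 1) ?_ ?_ ?_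
  · rintro _ _ ⟨d, hd, P, rfl, hP⟩ ⟨d', hd', P', rfl, hP'⟩
    refine ⟨d * d', mul_ne_zero hd hd', P * P', ?_, ?_⟩
    · rw [Matrix.map_mul, Matrix.smul_mul, Matrix.mul_smul, smul_smul]
    · rw [Matrix.map_mul, hP, hP', one_mul]
  · refine ⟨1, one_ne_zero, 1, ?_, ?_⟩
    · rw [one_smul, Matrix.map_one _ (map_zero _) (map_one _)]
    · rw [Matrix.map_one _ (map_zero _) (map_one _)]
  · intro X hX
    rw [List.mem_ofFn] at hX
    obtain ⟨k, rfl⟩ := hX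
    have hk : (polyMat N j k.succ).map (evalAt N j M) = 1 := by
      ext a b
      simp [polyMat, evalAt]
    split_ifs
    · refine ⟨(mat N j k.succ).det⁻¹, inv_ne_zero (mat_det_ne_zero N j _),
        (polyMat N j k.succ).adjugate, ?_, ?_⟩
      · rw [Matrix.inv_def, Ring.inverse_eq_inv', ← map_polyMat]
        congr 1
        exact (RingHom.map_adjugate _ _).symm
      · have := RingHom.map_adjugate (evalAt N j M) (polyMat N j k.succ)
        rw [RingHom.mapMatrix_apply, RingHom.mapMatrix_apply, hk, Matrix.adjugate_one] at this
        exact this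
    · refine ⟨1, one_ne_zero, (polyMat N j k.succ).transpose, ?_, ?_⟩
      · rw [one_smul, ← map_polyMat, Matrix.transpose_map]
      · rw [Matrix.transpose_map, hk, Matrix.transpose_one]

theorem minor_matS_ne_zero (N j : ℕ) {p : ℕ} (f g : Fin p → Fin N)
    (M : Matrix (Fin N) (Fin N) ℂ) (hM : (M.transpose.submatrix f g).det ≠ 0) :
    ((matS N j).submatrix f g).det ≠ 0 := by
  obtain ⟨d, hd, P, hP, hP1⟩ := exists_smul_map_of_prod N j M
  have h1 : matS N j = d • ((polyMat N j 0).transpose * P).map (algebraMap _ (RatFun N j)) := by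
    rw [matS, hP, Matrix.mul_smul, Matrix.map_mul]
    rfl
  have h2 : ((matS N j).submatrix f g).det = d ^ p *
      algebraMap _ (RatFun N j) (((polyMat N j 0).transpose * P).submatrix f g).det := by
    have h3 : (matS N j).submatrix f g = d • (((polyMat N j 0).transpose * P).submatrix f g).map
        (algebraMap _ (RatFun N j)) := by
      rw [h1]
      rfl
    rw [h3, Matrix.det_smul, Fintype.card_fin, RingHom.map_det]
    rfl
  rw [h2]
  refine mul_ne_zero (pow_ne_zero _ hd) ?_
  rw [Ne, map_eq_zero_iff _ (algebraMap_ratFun_injective N j)]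
  intro h
  have h3 := congrArg (evalAt N j M) h
  rw [RingHom.map_det, map_zero] at h3
  apply hM
  rw [← h3]
  have h4 : ((polyMat N j 0).transpose * P).map (evalAt N j M) = M.transpose := by
    rw [Matrix.map_mul, hP1, mul_one]
    ext a b
    simp [polyMat, evalAt]
  rw [← h4]
  rfl

theorem urMinor_antidiagonal_ne_zero (N p : ℕ) (hp : p ≤ N) :
    urMinor (antidiagonal (fun _ : Fin N => (1 : ℂ))) p hp ≠ 0 := by
  have h : (antidiagonal (fun _ : Fin N => (1 : ℂ))).submatrix (Fin.castLE hp)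
      (fun b : Fin p => (⟨N - p + b.val, by omega⟩ : Fin N)) =
      antidiagonal (fun _ : Fin p => (1 : ℂ)) := by
    ext a b
    simp only [antidiagonal, Matrix.submatrix_apply, Matrix.of_apply]
    refine if_congr ?_ rfl rfl
    rw [Fin.ext_iff, Fin.ext_iff, Fin.val_rev, Fin.val_rev, Fin.val_castLE]
    simp only
    omega
  rw [urMinor, h]
  exact antidiagonal_det_ne_zero fun _ => one_ne_zero

theorem urMinor_mat_ne_zero (N j : ℕ) (k : Fin (j + 1)) (p : ℕ) (hp : p ≤ N) :
    urMinor (mat N j k) p hp ≠ 0 :=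
  minor_mat_ne_zero N j k _ _ _ (urMinor_antidiagonal_ne_zero N p hp)

theorem urMinor_matS_ne_zero (N j : ℕ) (p : ℕ) (hp : p ≤ N) : urMinor (matS N j) p hp ≠ 0 := by
  refine minor_matS_ne_zero N j _ _
    (antidiagonal (fun _ : Fin N => (1 : ℂ))).transpose ?_
  rw [Matrix.transpose_transpose]
  exact urMinor_antidiagonal_ne_zero N p hp

theorem ulMinor_matS_ne_zero (N j : ℕ) (p : ℕ) (hp : p ≤ N) : ulMinor (matS N j) p hp ≠ 0 := by
  refine minor_matS_ne_zero N j _ _ 1 ?_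
  rw [Matrix.transpose_one, Matrix.submatrix_one _ (Fin.castLE_injective hp), Matrix.det_one]
  exact one_ne_zero

theorem casimirXEven_ne_zero (N j : ℕ) (p : Fin ((N + 1) / 2)) : casimirXEven N j p ≠ 0 :=
  div_ne_zero
    (mul_ne_zero (urMinor_matS_ne_zero N j _ _)
      (Finset.prod_ne_zero_iff.2 fun _ _ => urMinor_mat_ne_zero N j _ _ _))
    (mul_ne_zero (urMinor_matS_ne_zero N j _ _)
      (Finset.prod_ne_zero_iff.2 fun _ _ => urMinor_mat_ne_zero N j _ _ _))

theorem casimirXOdd_ne_zero (N r : ℕ) (p : Fin (N / 2)) : casimirXOdd N r p ≠ 0 :=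
  mul_ne_zero
    (div_ne_zero
      (mul_ne_zero (mul_ne_zero (ulMinor_matS_ne_zero N _ _ _) (ulMinor_matS_ne_zero N _ _ _))
        (Finset.prod_ne_zero_iff.2 fun _ _ =>
          mul_ne_zero (urMinor_mat_ne_zero N _ _ _ _) (urMinor_mat_ne_zero N _ _ _ _)))
      (Finset.prod_ne_zero_iff.2 fun _ _ =>
        mul_ne_zero (urMinor_mat_ne_zero N _ _ _ _) (urMinor_mat_ne_zero N _ _ _ _)))
    (div_ne_zero
      (Finset.prod_ne_zero_iff.2 fun _ _ => pow_ne_zero _ (mat_det_ne_zero N _ _))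
      (mul_ne_zero (mat_det_ne_zero N _ _)
        (Finset.prod_ne_zero_iff.2 fun _ _ => pow_ne_zero _ (mat_det_ne_zero N _ _))))

end Nonvanishing

/-! ### Joint independence and the number of Casimir functions. -/

theorem algebraicIndependent_even (N j : ℕ) (hj : Even j) :
    AlgebraicIndependent ℂ (Sum.elim (casimirY N j) (casimirXEven N j)) := by
  refine algebraicIndependent_sumElim_of_eigen
    (fun i : Fin ((N + 1) / 2) => torusDerivation N j (Fin.castLE (by omega) i))
    (algebraicIndependent_casimirY N j)
    (fun i p => (chainFlow_torus N j _).derivation_casimirY p) (casimirXEven_ne_zero N j)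
    (Matrix.of fun i p => if p ≤ i then -2 else 0) ?_
    (fun i p => isEigen_torus_casimirXEven j hj i p)
  rw [Matrix.det_of_isLowerTriangular]
  · simp
  · intro a b h
    simpa using h

theorem algebraicIndependent_odd (N r : ℕ) :
    AlgebraicIndependent ℂ (Sum.elim (casimirY N (2 * r + 1)) (casimirXOdd N r)) := by
  refine algebraicIndependent_sumElim_of_eigen
    (fun i : Fin (N / 2) => torusDerivation N (2 * r + 1) (Fin.castLE (by omega) i))
    (algebraicIndependent_casimirY N (2 * r + 1))
    (fun i p => (chainFlow_torus N (2 * r + 1) _).derivation_casimirY p)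
    (casimirXOdd_ne_zero N r)
    (Matrix.of fun i p => if i ≤ p then 2 else 0) ?_
    (fun i p => isEigen_torus_casimirXOdd r i p)
  rw [Matrix.det_of_isUpperTriangular]
  · simp
  · intro a b h
    simpa using h

theorem ncard_range_sumElim {F K ι κ : Type*} [Field F] [Field K] [Algebra F K] [Fintype ι]
    [Fintype κ] {Y : ι → K} {X : κ → K} (h : AlgebraicIndependent F (Sum.elim Y X)) :
    (Set.range (Sum.elim Y X)).ncard = Fintype.card ι + Fintype.card κ := by
  rw [← Set.image_univ, Set.ncard_image_of_injective _ h.injective, Set.ncard_univ,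
    Nat.card_eq_fintype_card, Fintype.card_sum]

end BChain

end

theorem theorem5p4 (N : ℕ) (hN : 1 ≤ N) :
    -- for all `j`: the functions `Y_1, …, Y_{[N/2]}`
    (∀ j : ℕ,
      BChain.pencil N j =
          LaurentPolynomial.T (N : ℤ) + LaurentPolynomial.T (-(N : ℤ)) +
            ∑ p : Fin (N / 2),
              (LaurentPolynomial.T ((N : ℤ) - 2 * (p.val + 1)) +
                LaurentPolynomial.T (2 * (p.val + 1) - (N : ℤ))) *
              LaurentPolynomial.C (BChain.casimirY N j p) ∧
        ∀ p, BChain.IsCasimir N j (BChain.casimirY N j p)) ∧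
    -- even `j`: `N` algebraically independent Casimir functions
    (∀ j : ℕ, Even j →
      (∀ p, BChain.IsCasimir N j (BChain.casimirXEven N j p)) ∧
        AlgebraicIndependent ℂ (Sum.elim (BChain.casimirY N j) (BChain.casimirXEven N j)) ∧
        (Set.range (Sum.elim (BChain.casimirY N j) (BChain.casimirXEven N j))).ncard = N) ∧
    -- odd `j = 2 r + 1`: `2 [N/2]` algebraically independent Casimir functions
    (∀ r : ℕ,
      (∀ p, BChain.IsCasimir N (2 * r + 1) (BChain.casimirXOdd N r p)) ∧
        AlgebraicIndependent ℂ
          (Sum.elim (BChain.casimirY N (2 * r + 1)) (BChain.casimirXOdd N r)) ∧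
        (Set.range
          (Sum.elim (BChain.casimirY N (2 * r + 1)) (BChain.casimirXOdd N r))).ncard =
          2 * (N / 2)) := by
  refine ⟨fun j => ⟨BChain.pencil_eq N j hN, BChain.isCasimir_casimirY N j⟩, fun j hj => ?_,
    fun r => ?_⟩
  · have h := BChain.algebraicIndependent_even N j hj
    refine ⟨BChain.isCasimir_casimirXEven N j hj, h, ?_⟩
    simp only [BChain.ncard_range_sumElim h, Fintype.card_fin]
    omega
  · have h := BChain.algebraicIndependent_odd N r
    refine ⟨BChain.isCasimir_casimirXOdd N r, h, ?_⟩
    simp only [BChain.ncard_range_sumElim h, Fintype.card_fin]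
    omega
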